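/- Let $n\ge 1$, let $\mathbb{B}^n\subset\mathbb{C}^n$ be the open unit ball and $\mathbb{R}_+=(0,\infty)$, $\mathbb{Z}_+=\{0,1,2,\dots\}$. For $\lambda>-1$ let $dv_\lambda(z)=c_\lambda(1-|z|^2)^\lambda\,dv(z)$ on $\mathbb{B}^n$, with $c_\lambda=\frac{\Gamma(n+\lambda+1)}{\pi^n\Gamma(\lambda+1)}$, let $\mathcal{A}^2_\lambda(\mathbb{B}^n)$ be the (closed) subspace of holomorphic functions in $L^2(\mathbb{B}^n,v_\lambda)$ with orthogonal projection $B_\lambda$, and for $a\in L^\infty(\mathbb{B}^n)$ let $T^{(\lambda)}_a=B_\lambda M_a$ be the Toeplitz operator on $\mathcal{A}^2_\lambda(\mathbb{B}^n)$. Write $(x)_m$ for the Pochhammer symbol, and for $p\in\mathbb{Z}^n_+$ write $|p|=\sum_j p_j$, $p!=\prod_j p_j!$. Put $$H(z)=\frac{(|z_1|^2,\dots,|z_n|^2)}{1-|z|^2},\qquad \kappa(t,h)=\frac{(t_1h_1^{1/2},\dots,t_nh_n^{1/2})}{(1+\|h\|_1)^{1/2}}\quad(t\in\mathbb{T}^n,\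 h\in\mathbb{R}^n_+),$$ $$d\widetilde\nu_\lambda(h)=\frac{c_\lambda\,dh}{2^n(1+\|h\|_1)^{n+\lambda+1}}\ \text{ on }\mathbb{R}^n_+,\qquad d\nu_\lambda(t,h)=\frac{dt}{it}\,d\widetilde\nu_\lambda(h)\ \text{ on }\mathbb{T}^n\times\mathbb{R}^n_+,$$ where $\frac{dt}{it}=\prod_j\frac{dt_j}{it_j}$ (so $\mathbb{T}^n$ has mass $(2\pi)^n$). Let $U_0:L^2(\mathbb{B}^n,v_\lambda)\to L^2(\mathbb{T}^n\times\mathbb{R}^n_+,\nu_\lambda)$, $U_0g=g\circ\kappa$; let $U_1:L^2(\mathbb{T}^n\times\mathbb{R}^n_+,\nu_\lambda)\to\ell^2(\mathbb{Z}^n,L^2(\mathbb{R}^n_+,\widetilde\nu_\lambda))$, $(U_1\varphi)(p,h)=(2\pi)^{-n/2}\int_{\mathbb{T}^n}\varphi(t,h)\,t^{-p}\frac{dt}{it}$; let $W_\lambda:\ell^2(\mathbb{Z}^n_+)\to\ell^2(\mathbb{Z}^n,L^2(\mathbb{R}^n_+,\widetilde\nu_\lambda))$, $$(W_\lambda\psi)(p,h)=\sqrt{\frac{(2\pi)^n(n+\lambda+1)_{|p|}}{p!\,(\lambda+1)_n}}\;\frac{h^{p/2}}{(1+\|h\|_1)^{|p|/2}}\,\psi(p)\quad(p\in\mathbb{Z}^n_+),$$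 and $(W_\lambda\psi)(p,\cdot)=0$ for $p\in\mathbb{Z}^n\setminus\mathbb{Z}^n_+$. These are well-defined bounded operators. Let $R_\lambda=W_\lambda^*U_1U_0:L^2(\mathbb{B}^n,v_\lambda)\to\ell^2(\mathbb{Z}^n_+)$. Theorem. Let $a\in L^\infty(\mathbb{B}^n)$ be a quasi-elliptic moment map symbol, i.e. $a=f\circ H$ almost everywhere with $f:\mathbb{R}^n_+\to\mathbb{C}$ measurable. Then for every $\lambda>-1$ the operator $R_\lambda^*$ takes its values in $\mathcal{A}^2_\lambda(\mathbb{B}^n)$ and $$R_\lambda\,T^{(\lambda)}_a\,R_\lambda^*=M_{\gamma_{a,\lambda}}\ \text{ on }\ell^2(\mathbb{Z}^n_+),\qquad \gamma_{a,\lambda}(p)=\frac{(n+\lambda+1)_{|p|}}{p!}\int_{\mathbb{R}^n_+}\frac{h^pf(h)}{(1+\|h\|_1)^{|p|+n+\lambda+1}}\,dh,$$ where the integrals converge absolutely. Moreover $T^{(\lambda)}_a$ is unitarily equivalent to a multiplier operator: the restriction $V_\lambda$ of $\sqrt{(\lambda+1)_n}\,R_\lambda$ to $\mathcal{A}^2_\lambda(\mathbb{B}^n)$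 is a unitary operator onto $\ell^2(\mathbb{Z}^n_+)$, and $$V_\lambda\,T^{(\lambda)}_a\,V_\lambda^{-1}=M_{(\lambda+1)_n\gamma_{a,\lambda}}.$$ -/

import Mathlib

open MeasureTheory Filter Topology
open scoped ENNReal

noncomputable section

namespace QuasiElliptic

/-- The open unit ball `𝔹ⁿ` of `ℂⁿ` for the Hermitian norm `|z|² = ∑ |z_j|²`. The type `Fin n → ℂ`
is used for `ℂⁿ` (with Lebesgue measure `volume`); its own (sup) norm plays no role here. -/
def unitBall (n : ℕ) : Set (Fin n → ℂ) := {z | ∑ j, ‖z j‖ ^ 2 < 1}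

/-- `ℝⁿ₊`, the open positive orthant. -/
def posOrthant (n : ℕ) : Set (Fin n → ℝ) := {h | ∀ j, 0 < h j}

/-- The Pochhammer symbol `(x)_m = x (x + 1) ⋯ (x + m - 1)`. -/
def poch (x : ℝ) (m : ℕ) : ℝ := (ascPochhammer ℝ m).eval x

/-- `c_λ = Γ(n + λ + 1) / (πⁿ Γ(λ + 1))`. -/
def cconst (n : ℕ) (lam : ℝ) : ℝ :=
  Real.Gamma (n + lam + 1) / (Real.pi ^ n * Real.Gamma (lam + 1))

/-- The density `c_λ (1 - |z|²)^λ`. -/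
def ballDensity (n : ℕ) (lam : ℝ) (z : Fin n → ℂ) : ℝ :=
  cconst n lam * (1 - ∑ j, ‖z j‖ ^ 2) ^ lam

/-- The weighted measure `dv_λ = c_λ (1 - |z|²)^λ dv` on the unit ball. -/
def ballMeasure (n : ℕ) (lam : ℝ) : Measure (Fin n → ℂ) :=
  (volume.restrict (unitBall n)).withDensity fun z => ENNReal.ofReal (ballDensity n lam z)

/-- The weighted Bergman space `A²_λ(𝔹ⁿ)`: the classes in `L²(𝔹ⁿ, v_λ)` that have a holomorphic
representative. -/
def bergman (n : ℕ) (lam : ℝ) : Submodule ℂ (Lp ℂ 2 (ballMeasure n lam)) where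
  carrier := {g | ∃ G : (Fin n → ℂ) → ℂ,
    DifferentiableOn ℂ G (unitBall n) ∧ g =ᵐ[ballMeasure n lam] G}
  zero_mem' := ⟨0, differentiableOn_const 0, Lp.coeFn_zero _ _ _⟩
  add_mem' := by
    rintro a b ⟨A, hA, hA'⟩ ⟨B, hB, hB'⟩
    exact ⟨A + B, hA.add hB, (Lp.coeFn_add a b).trans (hA'.add hB')⟩
  smul_mem' := by
    rintro c a ⟨A, hA, hA'⟩
    exact ⟨c • A, hA.const_smul c, (Lp.coeFn_smul c a).trans (hA'.const_smul c)⟩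

/-! ### The Bergman space is closed -/

lemma isOpen_unitBall (n : ℕ) : IsOpen (unitBall n) := by
  unfold unitBall
  exact isOpen_lt (by fun_prop) (by fun_prop)

lemma rotate_measurePreserving (n : ℕ) (θ : ℝ) :
    MeasurePreserving (fun w : Fin n → ℂ => fun j => (Circle.exp θ : ℂ) * w j) volume volume := by
  refine volume_preserving_pi (fun _ => ?_)
  exact (rotation (Circle.exp θ)).measurePreserving

lemma circle_enorm_le {F : ℂ → ℂ} {R : ℝ} (hR : 1 < R)
    (hF : DifferentiableOn ℂ F (Metric.ball 0 R)) :
    ENNReal.ofReal (2 * Real.pi) * ‖F 0‖ₑ ≤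
      ∫⁻ θ in Set.Ioc 0 (2 * Real.pi), ‖F (Circle.exp θ)‖ₑ := by
  have h1 : DiffContOnCl ℂ F (Metric.ball 0 |1|) := by
    refine DifferentiableOn.diffContOnCl (hF.mono ?_)
    rw [abs_one, closure_ball _ one_ne_zero]
    exact Metric.closedBall_subset_ball hR
  have h2 := h1.circleAverage
  rw [Real.circleAverage_def] at h2
  have hpi : (0 : ℝ) < 2 * Real.pi := by positivity
  rw [intervalIntegral.integral_of_le hpi.le] at h2
  have h3 : ∀ θ : ℝ, circleMap 0 1 θ = (Circle.exp θ : ℂ) := by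
    intro θ; simp [circleMap]
  simp_rw [h3] at h2
  rw [← h2, enorm_smul, ← mul_assoc]
  have h4 : ENNReal.ofReal (2 * Real.pi) * ‖(2 * Real.pi)⁻¹‖ₑ = 1 := by
    rw [Real.enorm_of_nonneg (by positivity), ← ENNReal.ofReal_mul hpi.le,
      mul_inv_cancel₀ hpi.ne', ENNReal.ofReal_one]
  rw [h4, one_mul]
  exact enorm_integral_le_lintegral_enorm _

lemma rotate_average_le {n : ℕ} {k : (Fin n → ℂ) → ℝ≥0∞} {s : Set (Fin n → ℂ)} {c : ℝ≥0∞}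
    (hs : MeasurableSet s) (hkm : Measurable k)
    (key : ∀ w ∈ s, ENNReal.ofReal (2 * Real.pi) * c ≤
      ∫⁻ θ in Set.Ioc 0 (2 * Real.pi), k (fun j => (Circle.exp θ : ℂ) * w j)) :
    ENNReal.ofReal (2 * Real.pi) * (volume s * c) ≤ ENNReal.ofReal (2 * Real.pi) * ∫⁻ w, k w := by
  have hmeas2 : Measurable (fun q : (Fin n → ℂ) × ℝ =>
      k (fun j => (Circle.exp q.2 : ℂ) * q.1 j)) := by
    refine hkm.comp ?_
    refine measurable_pi_lambda _ (fun j => Continuous.measurable ?_)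
    fun_prop
  have e1 : ENNReal.ofReal (2 * Real.pi) * (volume s * c) =
      ∫⁻ _w in s, ENNReal.ofReal (2 * Real.pi) * c := by
    rw [setLIntegral_const]; ring
  have e2 : (∫⁻ w : Fin n → ℂ, ∫⁻ θ in Set.Ioc 0 (2 * Real.pi), k (fun j => (Circle.exp θ : ℂ) * w j)) =
      ∫⁻ θ in Set.Ioc 0 (2 * Real.pi), ∫⁻ w : Fin n → ℂ, k (fun j => (Circle.exp θ : ℂ) * w j) :=
    lintegral_lintegral_swap hmeas2.aemeasurable
  have e3 : ∀ θ : ℝ, (∫⁻ w : Fin n → ℂ, k (fun j => (Circle.exp θ : ℂ) * w j)) = ∫⁻ w, k w :=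
    fun θ => (rotate_measurePreserving n θ).lintegral_comp hkm
  have e4 : (∫⁻ _θ in Set.Ioc 0 (2 * Real.pi), ∫⁻ w, k w) =
      ENNReal.ofReal (2 * Real.pi) * ∫⁻ w, k w := by
    rw [setLIntegral_const, Real.volume_Ioc, sub_zero, mul_comm]
  rw [e1, ← e4]
  simp_rw [e3] at e2
  rw [← e2]
  exact (setLIntegral_mono' hs key).trans (lintegral_mono' Measure.restrict_le_self le_rfl)

/-- Mean value inequality on a polydisc. -/
lemma polydisc_enorm_le {n : ℕ} {F : (Fin n → ℂ) → ℂ} {z : Fin n → ℂ} {r : ℝ} (_hr : 0 < r)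
    (hF : DifferentiableOn ℂ F (Metric.ball z r)) :
    volume (Metric.ball (0 : Fin n → ℂ) r) * ‖F z‖ₑ ≤
      ∫⁻ w in Metric.ball z r, ‖F w‖ₑ := by
  set k : (Fin n → ℂ) → ℝ≥0∞ := (Metric.ball (0 : Fin n → ℂ) r).indicator
    (fun w => ‖F (z + w)‖ₑ) with hk
  have hmaps : ∀ w ∈ Metric.ball (0 : Fin n → ℂ) r, z + w ∈ Metric.ball z r := by
    intro w hw; simpa using hw
  have hkm : Measurable k := by
    rw [hk]
    have hc : ContinuousOn (fun w => ‖F (z + w)‖ₑ) (Metric.ball (0 : Fin n → ℂ) r) := by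
      refine ContinuousOn.enorm ?_
      exact hF.continuousOn.comp (by fun_prop) hmaps
    classical
    rw [← Set.piecewise_eq_indicator]
    exact hc.measurable_piecewise continuousOn_const Metric.isOpen_ball.measurableSet
  have hpi : (0 : ℝ) < 2 * Real.pi := by positivity
  have hrot : ∀ (θ : ℝ) (w : Fin n → ℂ), ‖(fun j => (Circle.exp θ : ℂ) * w j)‖ = ‖w‖ := by
    intro θ w
    have : (fun j => (Circle.exp θ : ℂ) * w j) = (Circle.exp θ : ℂ) • w := by
      ext j; simp
    rw [this, norm_smul]; simp
  have key : ∀ w ∈ Metric.ball (0 : Fin n → ℂ) r, ENNReal.ofReal (2 * Real.pi) * ‖F z‖ₑ ≤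
      ∫⁻ θ in Set.Ioc 0 (2 * Real.pi), k (fun j => (Circle.exp θ : ℂ) * w j) := by
    intro w hw
    have hw' : ‖w‖ < r := by simpa using hw
    obtain ⟨R, hR1, hRr⟩ : ∃ R : ℝ, 1 < R ∧ R * ‖w‖ < r := by
      have : Tendsto (fun R : ℝ => R * ‖w‖) (𝓝[>] 1) (𝓝 (1 * ‖w‖)) :=
        (tendsto_id.mul_const ‖w‖).mono_left nhdsWithin_le_nhds
      rw [one_mul] at this
      have h := (this.eventually_lt_const hw').and self_mem_nhdsWithin
      obtain ⟨R, h1, h2⟩ := h.exists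
      exact ⟨R, h2, h1⟩
    have hd : DifferentiableOn ℂ (fun ζ : ℂ => F (z + ζ • w)) (Metric.ball 0 R) := by
      refine hF.comp (by fun_prop) ?_
      intro ζ hζ
      apply hmaps
      have : ‖ζ‖ < R := by simpa using hζ
      rw [mem_ball_zero_iff, norm_smul]
      exact lt_of_le_of_lt (mul_le_mul_of_nonneg_right this.le (norm_nonneg _)) hRr
    have h := circle_enorm_le hR1 hd
    simp only [zero_smul, add_zero] at h
    refine h.trans_eq ?_
    refine lintegral_congr (fun θ => ?_)
    rw [hk, Set.indicator_of_mem]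
    · congr 1
    · rw [mem_ball_zero_iff, hrot]; exact hw'
  have hsum := rotate_average_le Metric.isOpen_ball.measurableSet hkm key
  have hne : ENNReal.ofReal (2 * Real.pi) ≠ 0 := by simpa using Real.pi_pos
  have h5 := (ENNReal.mul_le_mul_iff_right hne ENNReal.ofReal_ne_top).1 hsum
  refine h5.trans_eq ?_
  rw [hk, ← lintegral_indicator Metric.isOpen_ball.measurableSet,
    ← lintegral_add_left_eq_self ((Metric.ball z r).indicator fun w => ‖F w‖ₑ) z]
  refine lintegral_congr (fun w => ?_)
  by_cases hw : w ∈ Metric.ball (0 : Fin n → ℂ) r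
  · rw [Set.indicator_of_mem hw, Set.indicator_of_mem (hmaps w hw)]
  · rw [Set.indicator_of_notMem hw, Set.indicator_of_notMem]
    simpa using hw

lemma cconst_pos {n : ℕ} {lam : ℝ} (hlam : -1 < lam) : 0 < cconst n lam := by
  unfold cconst
  have h1 : 0 < Real.Gamma (n + lam + 1) :=
    Real.Gamma_pos_of_pos (by have : (0 : ℝ) ≤ n := n.cast_nonneg; linarith)
  have h2 : 0 < Real.Gamma (lam + 1) := Real.Gamma_pos_of_pos (by linarith)
  positivity

/-- Point evaluations are locally uniformly bounded by the `L²` norm. -/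
lemma local_bound {n : ℕ} {lam : ℝ} (hlam : -1 < lam) {z₀ : Fin n → ℂ} (hz₀ : z₀ ∈ unitBall n) :
    ∃ r : ℝ, 0 < r ∧ Metric.ball z₀ r ⊆ unitBall n ∧ ∃ C : ℝ≥0∞, C ≠ ∞ ∧
      ∀ G : (Fin n → ℂ) → ℂ, DifferentiableOn ℂ G (unitBall n) → ∀ z ∈ Metric.ball z₀ r,
        ‖G z‖ₑ ^ 2 ≤ C * eLpNorm G 2 (ballMeasure n lam) ^ 2 := by
  have hpos : 0 < 1 - ∑ j, ‖z₀ j‖ ^ 2 := sub_pos.2 hz₀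
  have hd0 : 0 < ballDensity n lam z₀ :=
    mul_pos (cconst_pos hlam) (Real.rpow_pos_of_pos hpos _)
  have hcont : ContinuousAt (ballDensity n lam) z₀ := by
    unfold ballDensity
    refine continuousAt_const.mul (ContinuousAt.rpow_const ?_ (Or.inl hpos.ne'))
    exact Continuous.continuousAt (by fun_prop)
  have hev : ∀ᶠ z in 𝓝 z₀, ballDensity n lam z₀ / 2 < ballDensity n lam z ∧ z ∈ unitBall n :=
    (hcont.eventually_const_lt (half_lt_self hd0)).and ((isOpen_unitBall n).mem_nhds hz₀)
  obtain ⟨ρ, hρ, hball⟩ := Metric.eventually_nhds_iff_ball.1 hev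
  set δ : ℝ≥0∞ := ENNReal.ofReal (ballDensity n lam z₀ / 2) with hδ
  have hδ0 : δ ≠ 0 := by
    rw [hδ]; simpa using hd0
  set V : ℝ≥0∞ := volume (Metric.ball (0 : Fin n → ℂ) (ρ / 2)) with hV
  have hV0 : V ≠ 0 := (Metric.measure_ball_pos volume _ (half_pos hρ)).ne'
  refine ⟨ρ / 2, half_pos hρ, fun z hz => (hball z (Metric.ball_subset_ball (by linarith) hz)).2,
    V⁻¹ * δ⁻¹, ENNReal.mul_ne_top (ENNReal.inv_ne_top.2 hV0) (ENNReal.inv_ne_top.2 hδ0), ?_⟩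
  intro G hG z hz
  have hsub : Metric.ball z (ρ / 2) ⊆ Metric.ball z₀ ρ := by
    intro w hw
    rw [Metric.mem_ball] at *
    linarith [dist_triangle w z z₀]
  have h1 : DifferentiableOn ℂ (fun w => G w ^ 2) (Metric.ball z (ρ / 2)) :=
    (hG.mono (fun w hw => (hball w (hsub hw)).2)).pow 2
  have h2 := polydisc_enorm_le (half_pos hρ) h1
  have hnorm : eLpNorm G 2 (ballMeasure n lam) ^ 2 = ∫⁻ w, ‖G w‖ₑ ^ 2 ∂(ballMeasure n lam) := by
    rw [eLpNorm_eq_lintegral_rpow_enorm_toReal two_ne_zero ENNReal.ofNat_ne_top]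
    rw [← ENNReal.rpow_natCast, ← ENNReal.rpow_mul]
    simp
  have h3 : δ * ∫⁻ w in Metric.ball z (ρ / 2), ‖G w ^ 2‖ₑ ≤
      eLpNorm G 2 (ballMeasure n lam) ^ 2 := by
    rw [hnorm]
    have hle : δ • volume.restrict (Metric.ball z (ρ / 2)) ≤ ballMeasure n lam := by
      refine Measure.le_iff.2 (fun s hs => ?_)
      rw [ballMeasure, withDensity_apply _ hs, Measure.restrict_restrict hs, Measure.smul_apply,
        Measure.restrict_apply hs, smul_eq_mul, ← setLIntegral_const]
      calc ∫⁻ _ in s ∩ Metric.ball z (ρ / 2), δ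
          ≤ ∫⁻ w in s ∩ Metric.ball z (ρ / 2), ENNReal.ofReal (ballDensity n lam w) := by
            refine setLIntegral_mono' (hs.inter Metric.isOpen_ball.measurableSet) ?_
            intro w hw
            exact ENNReal.ofReal_le_ofReal (hball w (hsub hw.2)).1.le
        _ ≤ ∫⁻ w in s ∩ unitBall n, ENNReal.ofReal (ballDensity n lam w) := by
            refine lintegral_mono_set ?_
            exact Set.inter_subset_inter_right _ (fun w hw => (hball w (hsub hw)).2)
    calc δ * ∫⁻ w in Metric.ball z (ρ / 2), ‖G w ^ 2‖ₑ
        = ∫⁻ w, ‖G w‖ₑ ^ 2 ∂(δ • volume.restrict (Metric.ball z (ρ / 2))) := by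
          rw [lintegral_smul_measure]; simp [enorm_pow]
      _ ≤ _ := lintegral_mono' hle le_rfl
  rw [enorm_pow] at h2
  have hVt : V ≠ ∞ := measure_ball_lt_top.ne
  calc ‖G z‖ₑ ^ 2 = V⁻¹ * (V * ‖G z‖ₑ ^ 2) := by
        rw [← mul_assoc, ENNReal.inv_mul_cancel hV0 hVt, one_mul]
    _ ≤ V⁻¹ * ∫⁻ w in Metric.ball z (ρ / 2), ‖G w ^ 2‖ₑ := by gcongr
    _ = V⁻¹ * (δ⁻¹ * (δ * ∫⁻ w in Metric.ball z (ρ / 2), ‖G w ^ 2‖ₑ)) := by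
        rw [← mul_assoc δ⁻¹, ENNReal.inv_mul_cancel hδ0 ENNReal.ofReal_ne_top, one_mul]
    _ ≤ V⁻¹ * (δ⁻¹ * eLpNorm G 2 (ballMeasure n lam) ^ 2) := by gcongr
    _ = _ := by rw [mul_assoc]

/-- The Bergman space is a closed subspace of `L²(𝔹ⁿ, v_λ)`. -/
lemma isClosed_bergman (n : ℕ) {lam : ℝ} (hlam : -1 < lam) :
    IsClosed (bergman n lam : Set (Lp ℂ 2 (ballMeasure n lam))) := by
  refine IsSeqClosed.isClosed ?_
  intro g g₀ hg hlim
  choose G hGd hGe using hg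
  have hcauchy : CauchySeq g := hlim.cauchySeq
  have hdist : ∀ k l, eLpNorm (fun z => G k z - G l z) 2 (ballMeasure n lam) = edist (g k) (g l) := by
    intro k l
    rw [Lp.edist_def]
    exact eLpNorm_congr_ae ((hGe k).sub (hGe l)).symm
  -- uniform Cauchy estimate near each point
  have hunif : ∀ z₀ ∈ unitBall n, ∃ r : ℝ, 0 < r ∧ Metric.ball z₀ r ⊆ unitBall n ∧
      ∀ ε > 0, ∃ N, ∀ k ≥ N, ∀ l ≥ N, ∀ z ∈ Metric.ball z₀ r, ‖G k z - G l z‖ < ε := by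
    intro z₀ hz₀
    obtain ⟨r, hr, hsub, C, hC, hb⟩ := local_bound hlam hz₀
    refine ⟨r, hr, hsub, fun ε hε => ?_⟩
    obtain ⟨η, hη, hηC⟩ : ∃ η : ℝ≥0∞, 0 < η ∧ C * η ^ 2 < ENNReal.ofReal ε ^ 2 := by
      have ht : Tendsto (fun η : ℝ≥0∞ => C * η ^ 2) (𝓝[>] 0) (𝓝 (C * 0 ^ 2)) := by
        refine Tendsto.mono_left ?_ nhdsWithin_le_nhds
        refine ENNReal.Tendsto.const_mul ?_ (Or.inr hC)
        exact ENNReal.continuous_pow 2 |>.tendsto 0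
      have h0 : C * 0 ^ 2 < ENNReal.ofReal ε ^ 2 := by
        have h00 : 0 < ENNReal.ofReal ε := ENNReal.ofReal_pos.2 hε
        have h01 : 0 < ENNReal.ofReal ε ^ 2 := ENNReal.pow_pos h00 2
        simpa using h01
      obtain ⟨η, h1, h2⟩ := ((ht.eventually_lt_const h0).and self_mem_nhdsWithin).exists
      exact ⟨η, h2, h1⟩
    obtain ⟨N, hN⟩ := EMetric.cauchySeq_iff.1 hcauchy η hη
    refine ⟨N, fun k hk l hl z hz => ?_⟩
    have h1 := hb (fun z => G k z - G l z) ((hGd k).sub (hGd l)) z hz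
    rw [hdist] at h1
    have h2 : ‖G k z - G l z‖ₑ ^ 2 < ENNReal.ofReal ε ^ 2 := by
      refine lt_of_le_of_lt (h1.trans ?_) hηC
      gcongr
      exact (hN k hk l hl).le
    have h3 : ‖G k z - G l z‖ₑ < ENNReal.ofReal ε := lt_of_pow_lt_pow_left' 2 h2
    rw [← ofReal_norm] at h3
    exact (ENNReal.ofReal_lt_ofReal_iff hε).1 h3
  have hpt : ∀ z ∈ unitBall n, ∃ y, Tendsto (fun k => G k z) atTop (𝓝 y) := by
    intro z hz
    obtain ⟨r, hr, -, h⟩ := hunif z hz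
    refine cauchySeq_tendsto_of_complete (Metric.cauchySeq_iff.2 fun ε hε => ?_)
    obtain ⟨N, hN⟩ := h ε hε
    exact ⟨N, fun k hk l hl => by
      rw [dist_eq_norm]; exact hN k hk l hl z (Metric.mem_ball_self hr)⟩
  choose! G₀ hG₀ using hpt
  refine ⟨G₀, fun z₀ hz₀ => ?_, ?_⟩
  · obtain ⟨r, hr, hsub, h⟩ := hunif z₀ hz₀
    have hr2 : 0 < r / 2 := half_pos hr
    have hsub2 : Metric.ball z₀ (r / 2) ⊆ Metric.ball z₀ r := Metric.ball_subset_ball (by linarith)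
    have hat : ∀ k, ∀ z ∈ Metric.ball z₀ (r / 2), DifferentiableAt ℂ (G k) z := fun k z hz =>
      (hGd k).differentiableAt ((isOpen_unitBall n).mem_nhds (hsub (hsub2 hz)))
    have hder : ∀ ε > 0, ∃ N, ∀ k ≥ N, ∀ l ≥ N, ∀ z ∈ Metric.ball z₀ (r / 2),
        ‖fderiv ℂ (G k) z - fderiv ℂ (G l) z‖ < ε := by
      intro ε hε
      obtain ⟨N, hN⟩ := h (ε * r / 8) (by positivity)
      refine ⟨N, fun k hk l hl z hz => ?_⟩
      have hzb : Metric.ball z (r / 2) ⊆ Metric.ball z₀ r := by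
        intro w hw
        rw [Metric.mem_ball] at *
        linarith [dist_triangle w z z₀]
      have hm : Set.MapsTo (G k - G l) (Metric.ball z (r / 2))
          (Metric.closedBall ((G k - G l) z) (ε * r / 4)) := by
        intro w hw
        rw [Metric.mem_closedBall, dist_eq_norm]
        have h1 := hN k hk l hl w (hzb hw)
        have h2 := hN k hk l hl z (hsub2 hz)
        have h3 := norm_sub_le (G k w - G l w) (G k z - G l z)
        simp only [Pi.sub_apply]
        linarith
      have hle := Complex.norm_fderiv_le_div_of_mapsTo_ball
        (((hGd k).sub (hGd l)).mono (hzb.trans hsub)) hm hr2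
      rw [fderiv_sub (hat k z hz) (hat l z hz)] at hle
      refine lt_of_le_of_lt hle ?_
      rw [div_lt_iff₀ hr2]
      nlinarith [mul_pos hε hr]
    have hpt' : ∀ z ∈ Metric.ball z₀ (r / 2), ∃ y,
        Tendsto (fun k => fderiv ℂ (G k) z) atTop (𝓝 y) := by
      intro z hz
      refine cauchySeq_tendsto_of_complete (Metric.cauchySeq_iff.2 fun ε hε => ?_)
      obtain ⟨N, hN⟩ := hder ε hε
      exact ⟨N, fun k hk l hl => by rw [dist_eq_norm]; exact hN k hk l hl z hz⟩
    choose! D hD using hpt'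
    have hU : UniformCauchySeqOn (fun k => fderiv ℂ (G k)) atTop (Metric.ball z₀ (r / 2)) := by
      rw [Metric.uniformCauchySeqOn_iff]
      intro ε hε
      obtain ⟨N, hN⟩ := hder ε hε
      exact ⟨N, fun k hk l hl z hz => by rw [dist_eq_norm]; exact hN k hk l hl z hz⟩
    have hU' := hU.tendstoUniformlyOn_of_tendsto hD
    have := hasFDerivAt_of_tendstoUniformlyOn Metric.isOpen_ball hU'
      (fun k z hz => (hat k z hz).hasFDerivAt)
      (fun z hz => hG₀ z (hsub (hsub2 hz))) (Metric.mem_ball_self hr2)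
    exact this.differentiableAt.differentiableWithinAt
  · have hmeas := tendstoInMeasure_of_tendsto_Lp hlim
    obtain ⟨ns, hns, hae⟩ := hmeas.exists_seq_tendsto_ae
    have hmem : ∀ᵐ z ∂(ballMeasure n lam), z ∈ unitBall n :=
      (withDensity_absolutelyContinuous _ _).ae_le
        (ae_restrict_mem (isOpen_unitBall n).measurableSet)
    filter_upwards [hae, hmem, ae_all_iff.2 hGe] with z h1 h2 h3
    refine tendsto_nhds_unique h1 ?_
    have := (hG₀ z h2).comp hns.tendsto_atTop
    refine this.congr (fun k => ?_)
    simp [h3]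

lemma hasOrthogonalProjection_bergman (n : ℕ) {lam : ℝ} (hlam : -1 < lam) :
    (bergman n lam).HasOrthogonalProjection :=
  haveI : CompleteSpace (bergman n lam) := (isClosed_bergman n hlam).completeSpace_coe
  inferInstance

/-! ### Toeplitz operators -/

lemma memLp_top_ballMeasure {n : ℕ} {lam : ℝ} {a : (Fin n → ℂ) → ℂ}
    (ha : MemLp a ∞ (volume.restrict (unitBall n))) : MemLp a ∞ (ballMeasure n lam) := by
  have hac : ballMeasure n lam ≪ volume.restrict (unitBall n) :=
    withDensity_absolutelyContinuous _ _
  refine ⟨ha.1.mono_ac hac, ?_⟩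
  rw [eLpNorm_exponent_top]
  exact lt_of_le_of_lt (eLpNormEssSup_mono_measure a hac) (by simpa using ha.2)

/-- The multiplication operator `M_a g = a g` on `L²(𝔹ⁿ, v_λ)` for `a ∈ L^∞(𝔹ⁿ)`. -/
def mulOp {n : ℕ} (lam : ℝ) {a : (Fin n → ℂ) → ℂ}
    (ha : MemLp a ∞ (volume.restrict (unitBall n))) :
    Lp ℂ 2 (ballMeasure n lam) →L[ℂ] Lp ℂ 2 (ballMeasure n lam) :=
  (ContinuousLinearMap.mul ℂ ℂ).holderL (ballMeasure n lam) ∞ 2 2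
    ((memLp_top_ballMeasure ha).toLp a)

/-- The Toeplitz operator `T_a^{(λ)} = B_λ ∘ M_a` on the Bergman space, where `B_λ` is the
orthogonal projection of `L²(𝔹ⁿ, v_λ)` onto the Bergman space. -/
def toeplitz {n : ℕ} {lam : ℝ} (hlam : -1 < lam) {a : (Fin n → ℂ) → ℂ}
    (ha : MemLp a ∞ (volume.restrict (unitBall n))) : bergman n lam →L[ℂ] bergman n lam :=
  haveI := hasOrthogonalProjection_bergman n hlam
  (bergman n lam).orthogonalProjectionOnto ∘L mulOp lam ha ∘L (bergman n lam).subtypeL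

/-! ### Group-moment coordinates -/

/-- The (reparametrized) moment map `H(z) = (|z_1|², …, |z_n|²) / (1 - |z|²)`. -/
def momentH (n : ℕ) (z : Fin n → ℂ) : Fin n → ℝ :=
  fun j => ‖z j‖ ^ 2 / (1 - ∑ k, ‖z k‖ ^ 2)

/-- `‖h‖₁`. -/
def l1 {n : ℕ} (h : Fin n → ℝ) : ℝ := ∑ j, |h j|

/-- `κ(t, h) = (1 + ‖h‖₁)^{-1/2} (t_1 h_1^{1/2}, …, t_n h_n^{1/2})`. -/
def kappa (n : ℕ) (x : (Fin n → ℂ) × (Fin n → ℝ)) : Fin n → ℂ :=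
  fun j => ((1 / (1 + l1 x.2) ^ (1 / 2 : ℝ) : ℝ) : ℂ) * (x.1 j * ((x.2 j ^ (1 / 2 : ℝ) : ℝ) : ℂ))

/-- The measure `dt / (i t)` on the unit circle `𝕋 ⊆ ℂ`: with `t = e^{iθ}` it is `dθ`
(total mass `2π`), regarded as a measure on `ℂ` carried by `𝕋`. -/
def arcMeasure : Measure ℂ :=
  (volume.restrict (Set.Ioc (-Real.pi) Real.pi)).map fun θ : ℝ => Complex.exp (θ * Complex.I)

/-- The measure `dt / (i t) = ∏ dt_j / (i t_j)` on `𝕋ⁿ ⊆ ℂⁿ`. -/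
def torusMeasure (n : ℕ) : Measure (Fin n → ℂ) := Measure.pi fun _ => arcMeasure

/-- `dν̃_λ(h) = c_λ dh / (2ⁿ (1 + ‖h‖₁)^{n + λ + 1})` on `ℝⁿ₊`. -/
def nuTilde (n : ℕ) (lam : ℝ) : Measure (Fin n → ℝ) :=
  (volume.restrict (posOrthant n)).withDensity fun h =>
    ENNReal.ofReal (cconst n lam / (2 ^ n * (1 + l1 h) ^ ((n : ℝ) + lam + 1)))

/-- `ν_λ = dt / (i t) ⊗ ν̃_λ` on `𝕋ⁿ × ℝⁿ₊`. -/
def nu (n : ℕ) (lam : ℝ) : Measure ((Fin n → ℂ) × (Fin n → ℝ)) :=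
  (torusMeasure n).prod (nuTilde n lam)

/-- `ℓ²(ℤⁿ₊)`, with `ℤ₊ = {0, 1, 2, …}`. -/
abbrev ell2 (n : ℕ) : Type := lp (fun _ : Fin n → ℕ => ℂ) 2

/-- `ℓ²(ℤⁿ, L²(ℝⁿ₊, ν̃_λ))`. -/
abbrev ell2L2 (n : ℕ) (lam : ℝ) : Type := lp (fun _ : Fin n → ℤ => Lp ℂ 2 (nuTilde n lam)) 2

/-- `p! = p_1! ⋯ p_n!`. -/
def mfact {n : ℕ} (p : Fin n → ℕ) : ℝ := ∏ j, ((p j).factorial : ℝ)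

/-- `|p| = p_1 + ⋯ + p_n`. -/
def mlen {n : ℕ} (p : Fin n → ℕ) : ℕ := ∑ j, p j

/-- `U₀ g = g ∘ κ`. -/
def IsU₀ {n : ℕ} {lam : ℝ} (U₀ : Lp ℂ 2 (ballMeasure n lam) →L[ℂ] Lp ℂ 2 (nu n lam)) : Prop :=
  ∀ g : Lp ℂ 2 (ballMeasure n lam), U₀ g =ᵐ[nu n lam] fun x => g (kappa n x)

/-- `U₁ = 𝓕_n ⊗ I`, where `(𝓕_n φ)(p) = (2π)^{-n/2} ∫_{𝕋ⁿ} φ(t) t^{-p} dt / (i t)`. -/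
def IsU₁ {n : ℕ} {lam : ℝ} (U₁ : Lp ℂ 2 (nu n lam) →L[ℂ] ell2L2 n lam) : Prop :=
  ∀ (φ : Lp ℂ 2 (nu n lam)) (p : Fin n → ℤ), U₁ φ p =ᵐ[nuTilde n lam] fun h =>
    ((1 / (2 * Real.pi) ^ ((n : ℝ) / 2) : ℝ) : ℂ) *
      ∫ t, φ (t, h) * ∏ j, t j ^ (-p j) ∂(torusMeasure n)

/-- `(W_λ ψ)(p, h) = √((2π)ⁿ (n + λ + 1)_{|p|} / (p! (λ + 1)_n)) h^{p/2} (1 + ‖h‖₁)^{-|p|/2} ψ(p)`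
for `p ∈ ℤⁿ₊`, and `0` for `p ∈ ℤⁿ ∖ ℤⁿ₊`. -/
def IsW {n : ℕ} {lam : ℝ} (W : ell2 n →L[ℂ] ell2L2 n lam) : Prop :=
  ∀ ψ : ell2 n,
    (∀ p : Fin n → ℕ, W ψ (fun j => (p j : ℤ)) =ᵐ[nuTilde n lam] fun h =>
      ((√((2 * Real.pi) ^ n * poch (n + lam + 1) (mlen p) / (mfact p * poch (lam + 1) n)) *
        ((∏ j, h j ^ ((p j : ℝ) / 2)) / (1 + l1 h) ^ ((mlen p : ℝ) / 2)) : ℝ) : ℂ) * ψ p) ∧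
    ∀ q : Fin n → ℤ, (∃ j, q j < 0) → W ψ q = 0

/-- The integrand `h^p f(h) / (1 + ‖h‖₁)^{|p| + n + λ + 1}`. -/
def gammaIntegrand {n : ℕ} (lam : ℝ) (f : (Fin n → ℝ) → ℂ) (p : Fin n → ℕ) (h : Fin n → ℝ) : ℂ :=
  (((∏ j, h j ^ p j) / (1 + l1 h) ^ ((mlen p : ℝ) + n + lam + 1) : ℝ) : ℂ) * f h

/-- `γ_{a,λ}(p) = (n + λ + 1)_{|p|} / p! ∫_{ℝⁿ₊} h^p f(h) / (1 + ‖h‖₁)^{|p| + n + λ + 1} dh`. -/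
def gammaSeq {n : ℕ} (lam : ℝ) (f : (Fin n → ℝ) → ℂ) (p : Fin n → ℕ) : ℂ :=
  ((poch (n + lam + 1) (mlen p) / mfact p : ℝ) : ℂ) *
    ∫ h in posOrthant n, gammaIntegrand lam f p h

end QuasiElliptic

end

noncomputable section

namespace QuasiElliptic

/-! In the coordinates z = κ(t, h) the whole problem separates. Polar coordinates in the squared
radii s_j = |z_j|², followed by the projective map s = h / (1 + ‖h‖₁), whose Jacobian determinant is
(1 + ‖h‖₁)^{-(n+1)}, carry ν_λ to v_λ (`measurePreserving_kappa`), so U₀ is an isometry. Since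
H(κ(t, h)) = h, the symbol becomes the function f(h). The monomial z^p becomes the character t^p
times a function of h, and up to a constant this function is the profile that W_λ places at p
(`monoFun_kappa`).

Consequently (R_λ g)(p) = ⟨e_p, g⟩ for a suitable multiple e_p of z^p (`bargmannOp_apply`). In ⟨e_p,
a e_q⟩ the torus integral gives the Kronecker delta and the integral over h gives γ(p)
(`inner_monoLp_mulOp`). For a = 1 the Dirichlet integral gives ‖e_p‖² = 1/(λ+1)_n for every p, which
is where the normalisation √(λ+1)_n of V_λ comes from.

It remains to see that the monomials are total in the Bergman space
(`eq_zero_of_inner_monoLp_eq_zero`). On the torus |z_j| = r_j the q-th Fourier coefficient of a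
holomorphic G is c_q r^q, by Cauchy's theorem in one variable at a time, and it vanishes if some q_j
< 0. Orthogonality of G to e_p forces c_p = 0, and a continuous function on the torus without
Fourier coefficients is zero. So the √(λ+1)_n e_p form a Hilbert basis with coordinate map V_λ, and
R_λ = (λ+1)_n^{-1/2} V_λ B_λ. Both formulas of the theorem then express the same diagonal matrix. -/

/-! ### The torus measure and polar coordinates in the squared radii -/

lemma measurable_cexp_ofReal_mul_I : Measurable fun θ : ℝ => Complex.exp (θ * Complex.I) :=
  Continuous.measurable (by fun_prop)

instance isFiniteMeasure_arcMeasure : IsFiniteMeasure arcMeasure := by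
  unfold arcMeasure
  infer_instance

instance isFiniteMeasure_torusMeasure (n : ℕ) : IsFiniteMeasure (torusMeasure n) := by
  unfold torusMeasure
  infer_instance

lemma ae_norm_eq_one_arcMeasure : ∀ᵐ t ∂arcMeasure, ‖t‖ = 1 := by
  rw [arcMeasure, ae_map_iff measurable_cexp_ofReal_mul_I.aemeasurable
    (measurableSet_eq_fun measurable_norm measurable_const)]
  exact Eventually.of_forall fun θ => Complex.norm_exp_ofReal_mul_I θ

lemma ae_norm_eq_one_torusMeasure (n : ℕ) : ∀ᵐ t ∂torusMeasure n, ∀ j, ‖t j‖ = 1 := by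
  refine ae_all_iff.2 fun j => ?_
  exact (Measure.tendsto_eval_ae_ae (μ := fun _ : Fin n => arcMeasure) (i := j)).eventually
    ae_norm_eq_one_arcMeasure

/-- Substitution s = r², ds = 2r dr: the weight 1/2 on ds matches the polar area element r dr. -/
lemma lintegral_comp_sqrt_Ioi (F : ℝ → ℝ≥0∞) :
    ∫⁻ s in Set.Ioi (0 : ℝ), ENNReal.ofReal (1 / 2) * F (s ^ (1 / 2 : ℝ)) =
      ∫⁻ r in Set.Ioi (0 : ℝ), ENNReal.ofReal r * F r := by
  have himg : (fun r : ℝ => r ^ 2) '' Set.Ioi 0 = Set.Ioi 0 := by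
    ext s
    simp only [Set.mem_image, Set.mem_Ioi]
    constructor
    · rintro ⟨r, hr, rfl⟩
      positivity
    · intro hs
      exact ⟨√s, Real.sqrt_pos.2 hs, Real.sq_sqrt hs.le⟩
  have hinj : Set.InjOn (fun r : ℝ => r ^ 2) (Set.Ioi 0) := fun x hx y hy h =>
    (pow_left_inj₀ (le_of_lt hx) (le_of_lt hy) two_ne_zero).1 h
  have hder : ∀ x ∈ Set.Ioi (0 : ℝ),
      HasDerivWithinAt (fun r : ℝ => r ^ 2) (2 * x) (Set.Ioi 0) x := fun x _ => by
    simpa using (hasDerivAt_pow 2 x).hasDerivWithinAt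
  have := lintegral_image_eq_lintegral_abs_deriv_mul measurableSet_Ioi hder hinj
    (fun s => ENNReal.ofReal (1 / 2) * F (s ^ (1 / 2 : ℝ)))
  rw [himg] at this
  rw [this]
  refine setLIntegral_congr_fun measurableSet_Ioi fun r hr => ?_
  have hr' : 0 < r := hr
  rw [← Real.sqrt_eq_rpow, Real.sqrt_sq hr'.le, ← mul_assoc, ← ENNReal.ofReal_mul (abs_nonneg _),
    abs_of_pos (by positivity)]
  congr 2
  ring

/-- Half of Lebesgue measure on the positive half-line. -/
def halfMeasure : Measure ℝ := ENNReal.ofReal (1 / 2) • volume.restrict (Set.Ioi 0)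

instance sigmaFinite_halfMeasure : SigmaFinite halfMeasure := by
  rw [halfMeasure, ← withDensity_const]
  exact SigmaFinite.withDensity_of_ne_top (Eventually.of_forall fun _ => ENNReal.ofReal_ne_top)

/-- Polar coordinates on `ℂ` in the squared radius. -/
lemma measurePreserving_mul_sqrt :
    MeasurePreserving (fun x : ℂ × ℝ => x.1 * ((x.2 ^ (1 / 2 : ℝ) : ℝ) : ℂ))
      (arcMeasure.prod halfMeasure) volume := by
  have hm : Measurable (fun x : ℂ × ℝ => x.1 * ((x.2 ^ (1 / 2 : ℝ) : ℝ) : ℂ)) := by fun_prop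
  refine ⟨hm, Measure.ext_of_lintegral _ fun F hF => ?_⟩
  have hFm : Measurable fun x : ℂ × ℝ => F (x.1 * ((x.2 ^ (1 / 2 : ℝ) : ℝ) : ℂ)) := hF.comp hm
  rw [lintegral_map hF hm, lintegral_prod _ hFm.aemeasurable, arcMeasure,
    lintegral_map (Measurable.lintegral_prod_right' hFm) measurable_cexp_ofReal_mul_I,
    ← Complex.lintegral_comp_polarCoord_symm, Measure.volume_eq_prod, polarCoord_target,
    ← Measure.prod_restrict, lintegral_prod_symm]
  -- The target of `polarCoord` has an open interval of angles, `arcMeasure` a half-open one; they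
  -- differ by a null set.
  · rw [Measure.restrict_congr_set (Ioo_ae_eq_Ioc (a := -Real.pi) (b := Real.pi)).symm]
    refine lintegral_congr fun θ => ?_
    rw [halfMeasure, lintegral_smul_measure, smul_eq_mul, ← lintegral_const_mul]
    · have := lintegral_comp_sqrt_Ioi (fun r => F (Complex.exp (θ * Complex.I) * (r : ℂ)))
      rw [this]
      refine lintegral_congr fun r => ?_
      rw [Complex.polarCoord_symm_apply, Complex.exp_mul_I, smul_eq_mul, mul_comm (r : ℂ)]
      simp
    · exact hF.comp (by fun_prop)
  · refine Measurable.aemeasurable ?_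
    simp only [Complex.polarCoord_symm_apply, smul_eq_mul]
    exact (by fun_prop : Measurable fun x : ℝ × ℝ => ENNReal.ofReal x.1).mul
      (hF.comp (by fun_prop))

/-- The factor (1/2)ⁿ obtained here is the `2 ^ n` in the denominator of the density of `nuTilde`.
-/
lemma pi_halfMeasure (n : ℕ) : (Measure.pi fun _ : Fin n => halfMeasure) =
    ENNReal.ofReal (1 / 2) ^ n • volume.restrict (posOrthant n) := by
  refine Measure.pi_eq fun s hs => ?_
  have h1 : posOrthant n = Set.univ.pi fun _ => Set.Ioi 0 := by
    ext h; simp [posOrthant]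
  rw [h1, volume_pi, Measure.restrict_pi_pi, Measure.smul_apply, Measure.pi_pi]
  simp [halfMeasure, Finset.prod_mul_distrib]

/-- Polar coordinates on `ℂⁿ` in the squared radii. -/
lemma measurePreserving_pi_mul_sqrt (n : ℕ) :
    MeasurePreserving
      (fun (x : (Fin n → ℂ) × (Fin n → ℝ)) j => x.1 j * ((x.2 j ^ (1 / 2 : ℝ) : ℝ) : ℂ))
      ((torusMeasure n).prod (ENNReal.ofReal (1 / 2) ^ n • volume.restrict (posOrthant n)))
      volume := by
  rw [← pi_halfMeasure, torusMeasure]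
  have h1 := measurePreserving_pi (fun _ : Fin n => arcMeasure.prod halfMeasure)
    (fun _ => volume) fun _ => measurePreserving_mul_sqrt
  have h2 := (measurePreserving_arrowProdEquivProdArrow ℂ ℝ (Fin n) (fun _ => arcMeasure)
    (fun _ => halfMeasure)).symm
  exact h1.comp h2

/-! ### From the orthant to the simplex: κ is measure preserving -/

/-- The open standard simplex `{s | 0 < s_j, ∑ s_j < 1}`. -/
def openSimplex (n : ℕ) : Set (Fin n → ℝ) := {s | (∀ j, 0 < s j) ∧ ∑ j, s j < 1}

/-- The map `h ↦ h / (1 + ∑ h_j)` from the positive orthant onto the open simplex. -/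
def simplexMap (n : ℕ) (h : Fin n → ℝ) : Fin n → ℝ := fun j => h j / (1 + ∑ k, h k)

/-- The Jacobian matrix of `simplexMap`. -/
def simplexJacobian (n : ℕ) (h : Fin n → ℝ) : Matrix (Fin n) (Fin n) ℝ :=
  (1 + ∑ k, h k)⁻¹ • (1 + Matrix.replicateCol Unit (fun j => -(h j / (1 + ∑ k, h k))) *
    Matrix.replicateRow Unit fun _ : Fin n => (1 : ℝ))

lemma measurableSet_posOrthant (n : ℕ) : MeasurableSet (posOrthant n) := by
  have h1 : posOrthant n = Set.univ.pi fun _ => Set.Ioi 0 := by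
    ext h; simp [posOrthant]
  rw [h1]
  exact MeasurableSet.univ_pi fun _ => measurableSet_Ioi

lemma measurableSet_openSimplex (n : ℕ) : MeasurableSet (openSimplex n) :=
  (measurableSet_posOrthant n).inter
    (measurableSet_lt (by fun_prop) measurable_const : MeasurableSet {s : Fin n → ℝ | ∑ j, s j < 1})

lemma l1_eq_sum {n : ℕ} {h : Fin n → ℝ} (hh : h ∈ posOrthant n) : l1 h = ∑ j, h j :=
  Finset.sum_congr rfl fun j _ => abs_of_pos (hh j)

lemma one_add_sum_pos {n : ℕ} {h : Fin n → ℝ} (hh : h ∈ posOrthant n) : 0 < 1 + ∑ j, h j := by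
  have : 0 ≤ ∑ j, h j := Finset.sum_nonneg fun j _ => (hh j).le
  linarith

lemma l1_nonneg {n : ℕ} (h : Fin n → ℝ) : 0 ≤ l1 h := Finset.sum_nonneg fun _ _ => abs_nonneg _

lemma one_add_l1_pos {n : ℕ} (h : Fin n → ℝ) : 0 < 1 + l1 h := by linarith [l1_nonneg h]

lemma measurable_l1 {n : ℕ} : Measurable (l1 : (Fin n → ℝ) → ℝ) := by
  unfold l1
  fun_prop

/-- With σ = ∑ h_k, the matrix is (1 + σ)⁻¹ times a rank-one perturbation of the identity. The
scalar contributes (1 + σ)^{-n}, and the matrix determinant lemma contributes 1 - σ/(1 + σ) = (1 +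
σ)⁻¹. -/
lemma det_simplexJacobian {n : ℕ} {h : Fin n → ℝ} (hh : h ∈ posOrthant n) :
    (simplexJacobian n h).det = ((1 + ∑ k, h k) ^ (n + 1))⁻¹ := by
  have hpos := one_add_sum_pos hh
  rw [simplexJacobian, Matrix.det_smul, Matrix.det_one_add_replicateCol_mul_replicateRow,
    Fintype.card_fin]
  have h1 : (fun _ : Fin n => (1 : ℝ)) ⬝ᵥ (fun j => -(h j / (1 + ∑ k, h k))) =
      -((∑ k, h k) / (1 + ∑ k, h k)) := by
    simp [dotProduct, Finset.sum_div]
  rw [h1, pow_succ, mul_inv, inv_pow]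
  congr 1
  field_simp
  ring

lemma hasFDerivAt_simplexMap {n : ℕ} {h : Fin n → ℝ} (hh : h ∈ posOrthant n) :
    HasFDerivAt (simplexMap n) (LinearMap.toContinuousLinearMap
      (Matrix.toLin' (simplexJacobian n h))) h := by
  have hpos := one_add_sum_pos hh
  rw [hasFDerivAt_pi']
  intro j
  have h1 : HasFDerivAt (fun x : Fin n → ℝ => x j) (ContinuousLinearMap.proj (R := ℝ) j) h :=
    hasFDerivAt_apply j h
  have h2 : HasFDerivAt (fun x : Fin n → ℝ => 1 + ∑ k, x k)
      (∑ k, ContinuousLinearMap.proj (R := ℝ) (φ := fun _ : Fin n => ℝ) k) h :=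
    (HasFDerivAt.fun_sum fun k _ => hasFDerivAt_apply k h).const_add 1
  have h3 := h1.mul ((hasDerivAt_inv hpos.ne').comp_hasFDerivAt h h2)
  refine HasFDerivAt.congr_fderiv (h3.congr_of_eventuallyEq (Eventually.of_forall fun x =>
    by simp [simplexMap, div_eq_mul_inv])) ?_
  ext v
  simp only [simplexJacobian, ContinuousLinearMap.comp_apply, ContinuousLinearMap.proj_apply,
    LinearMap.coe_toContinuousLinearMap', Matrix.toLin'_apply, Matrix.smul_mulVec, Matrix.add_mulVec,
    Matrix.one_mulVec, Pi.smul_apply, Pi.add_apply, smul_eq_mul, smul_apply, add_apply,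
    sum_apply, Function.comp_apply, ← Matrix.mulVec_mulVec]
  have h4 : (Matrix.replicateCol Unit (fun j => -(h j / (1 + ∑ k, h k)))).mulVec
      ((Matrix.replicateRow Unit fun _ : Fin n => (1 : ℝ)).mulVec v) j =
      -(h j / (1 + ∑ k, h k)) * ∑ k, v k := by
    simp [Matrix.mulVec, dotProduct]
  rw [h4]
  field_simp
  ring

/-- In terms of z this is 1 - |z|² = 1/(1 + ‖h‖₁), which turns the weight (1 - |z|²)^λ into a power
of 1 + ‖h‖₁. -/
lemma sum_simplexMap {n : ℕ} {h : Fin n → ℝ} (hh : h ∈ posOrthant n) :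
    1 - ∑ j, simplexMap n h j = (1 + ∑ j, h j)⁻¹ := by
  have hpos := one_add_sum_pos hh
  simp only [simplexMap]
  rw [← Finset.sum_div]
  field_simp
  ring

lemma simplexMap_mem {n : ℕ} {h : Fin n → ℝ} (hh : h ∈ posOrthant n) :
    simplexMap n h ∈ openSimplex n := by
  refine ⟨fun j => div_pos (hh j) (one_add_sum_pos hh), ?_⟩
  have h1 := sum_simplexMap hh
  have h2 := inv_pos.2 (one_add_sum_pos hh)
  linarith

/-- The inverse s ↦ s/(1 - ∑ s_k) is the formula of `momentH` written in the squared moduli. -/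
lemma simplexMap_leftInv {n : ℕ} {h : Fin n → ℝ} (hh : h ∈ posOrthant n) (j : Fin n) :
    simplexMap n h j / (1 - ∑ k, simplexMap n h k) = h j := by
  have hpos := one_add_sum_pos hh
  rw [sum_simplexMap hh, simplexMap]
  field_simp

lemma injOn_simplexMap (n : ℕ) : Set.InjOn (simplexMap n) (posOrthant n) := by
  intro h hh h' hh' heq
  ext j
  rw [← simplexMap_leftInv hh, ← simplexMap_leftInv hh', heq]

lemma image_simplexMap (n : ℕ) : simplexMap n '' posOrthant n = openSimplex n := by
  refine Set.Subset.antisymm (Set.image_subset_iff.2 fun h hh => simplexMap_mem hh) ?_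
  rintro s ⟨hs, hs1⟩
  have hpos : 0 < 1 - ∑ j, s j := sub_pos.2 hs1
  refine ⟨fun j => s j / (1 - ∑ k, s k), fun j => div_pos (hs j) hpos, ?_⟩
  ext j
  simp only [simplexMap]
  rw [← Finset.sum_div]
  field_simp
  ring

lemma setLIntegral_openSimplex {n : ℕ} (G : (Fin n → ℝ) → ℝ≥0∞) :
    ∫⁻ s in openSimplex n, G s =
      ∫⁻ h in posOrthant n, ENNReal.ofReal ((1 + l1 h) ^ (n + 1))⁻¹ * G (simplexMap n h) := by
  rw [← image_simplexMap, lintegral_image_eq_lintegral_abs_det_fderiv_mul volume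
    (measurableSet_posOrthant n) (fun h hh => (hasFDerivAt_simplexMap hh).hasFDerivWithinAt)
    (injOn_simplexMap n)]
  refine setLIntegral_congr_fun (measurableSet_posOrthant n) fun h hh => ?_
  have hpos := one_add_sum_pos hh
  rw [LinearMap.det_toContinuousLinearMap, LinearMap.det_toLin', det_simplexJacobian hh,
    l1_eq_sum hh, abs_of_pos (by positivity)]

/-- This factors κ as the polar map of `measurePreserving_pi_mul_sqrt` after `simplexMap`, so that
the image of ν_λ can be found in two changes of variables. -/
lemma kappa_eq {n : ℕ} {h : Fin n → ℝ} (hh : h ∈ posOrthant n) (t : Fin n → ℂ) :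
    kappa n (t, h) = fun j => t j * ((simplexMap n h j ^ (1 / 2 : ℝ) : ℝ) : ℂ) := by
  ext j
  have hpos := one_add_sum_pos hh
  rw [kappa, simplexMap, l1_eq_sum hh, Real.div_rpow (hh j).le hpos.le]
  push_cast
  ring

lemma measurable_kappa (n : ℕ) : Measurable (kappa n) := by
  refine measurable_pi_lambda _ fun j => ?_
  have : Measurable (l1 : (Fin n → ℝ) → ℝ) := measurable_l1
  unfold kappa
  fun_prop

lemma norm_sq_mul_sqrt {t : ℂ} (ht : ‖t‖ = 1) {s : ℝ} (hs : 0 ≤ s) :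
    ‖t * ((s ^ (1 / 2 : ℝ) : ℝ) : ℂ)‖ ^ 2 = s := by
  rw [norm_mul, ht, one_mul, Complex.norm_real, ← Real.sqrt_eq_rpow,
    Real.norm_of_nonneg (Real.sqrt_nonneg _), Real.sq_sqrt hs]

lemma measurable_ballDensity (n : ℕ) (lam : ℝ) : Measurable (ballDensity n lam) := by
  unfold ballDensity
  fun_prop

/-- The group-moment coordinates `κ` carry `ν_λ` to `v_λ`. -/
lemma measurePreserving_kappa (n : ℕ) {lam : ℝ} (hlam : -1 < lam) :
    MeasurePreserving (kappa n) (nu n lam) (ballMeasure n lam) := by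
  refine ⟨measurable_kappa n, Measure.ext_of_lintegral _ fun F hF => ?_⟩
  have hFk : Measurable fun x => F (kappa n x) := hF.comp (measurable_kappa n)
  have hdens : Measurable fun z => ENNReal.ofReal (ballDensity n lam z) :=
    (measurable_ballDensity n lam).ennreal_ofReal
  have hl1 : Measurable (l1 : (Fin n → ℝ) → ℝ) := measurable_l1
  have hnd : Measurable fun h : Fin n → ℝ =>
      ENNReal.ofReal (cconst n lam / (2 ^ n * (1 + l1 h) ^ ((n : ℝ) + lam + 1))) := by
    fun_prop
  have hball := (isOpen_unitBall n).measurableSet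
  rw [lintegral_map hF (measurable_kappa n), nu]
  have : SFinite (nuTilde n lam) := by unfold nuTilde; infer_instance
  rw [lintegral_prod _ hFk.aemeasurable, ballMeasure,
    lintegral_withDensity_eq_lintegral_mul _ hdens hF, ← lintegral_indicator hball]
  have hK : Measurable ((unitBall n).indicator
      ((fun z => ENNReal.ofReal (ballDensity n lam z)) * F)) := (hdens.mul hF).indicator hball
  rw [← (measurePreserving_pi_mul_sqrt n).lintegral_comp hK, lintegral_prod]
  swap
  · exact (hK.comp (measurePreserving_pi_mul_sqrt n).measurable).aemeasurable
  refine lintegral_congr_ae ?_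
  filter_upwards [ae_norm_eq_one_torusMeasure n] with t ht
  have hFt : Measurable fun h => F (kappa n (t, h)) := hFk.comp measurable_prodMk_left
  rw [nuTilde, lintegral_withDensity_eq_lintegral_mul _ hnd hFt, lintegral_smul_measure]
  -- For unimodular t the point with squared radii s has |z|² = ∑ s_j, so within the orthant the
  -- ball cuts out the simplex.
  have e1 : ∫⁻ s in posOrthant n, (unitBall n).indicator
      ((fun z => ENNReal.ofReal (ballDensity n lam z)) * F)
        (fun j => t j * ((s j ^ (1 / 2 : ℝ) : ℝ) : ℂ)) =
      ∫⁻ s in openSimplex n, ENNReal.ofReal (cconst n lam * (1 - ∑ j, s j) ^ lam) *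
        F (fun j => t j * ((s j ^ (1 / 2 : ℝ) : ℝ) : ℂ)) := by
    rw [← lintegral_indicator (measurableSet_posOrthant n),
      ← lintegral_indicator (measurableSet_openSimplex n)]
    refine lintegral_congr fun s => ?_
    by_cases hs : s ∈ posOrthant n
    · have hn : ∑ j, ‖t j * ((s j ^ (1 / 2 : ℝ) : ℝ) : ℂ)‖ ^ 2 = ∑ j, s j :=
        Finset.sum_congr rfl fun j _ => norm_sq_mul_sqrt (ht j) (hs j).le
      rw [Set.indicator_of_mem hs]
      by_cases hs1 : ∑ j, s j < 1
      · rw [Set.indicator_of_mem (show s ∈ openSimplex n from ⟨hs, hs1⟩), Set.indicator_of_mem]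
        · simp only [Pi.mul_apply, ballDensity, hn]
        · simpa only [unitBall, Set.mem_ofPred_eq, hn] using hs1
      · rw [Set.indicator_of_notMem (fun h : s ∈ openSimplex n => hs1 h.2),
          Set.indicator_of_notMem]
        simpa only [unitBall, Set.mem_ofPred_eq, hn] using hs1
    · rw [Set.indicator_of_notMem hs, Set.indicator_of_notMem (fun h => hs h.1)]
  rw [e1, setLIntegral_openSimplex, smul_eq_mul, ← lintegral_const_mul']
  swap
  · exact ENNReal.pow_ne_top ENNReal.ofReal_ne_top
  refine setLIntegral_congr_fun (measurableSet_posOrthant n) fun h hh => ?_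
  have hpos := one_add_sum_pos hh
  have hc := cconst_pos (n := n) hlam
  simp only [Pi.mul_apply]
  rw [kappa_eq hh, sum_simplexMap hh, l1_eq_sum hh, ← mul_assoc, ← mul_assoc]
  congr 1
  rw [← ENNReal.ofReal_pow (by norm_num), ← ENNReal.ofReal_mul (by positivity),
    ← ENNReal.ofReal_mul (by positivity)]
  congr 1
  -- The weight supplies the exponent -λ and the Jacobian the exponent -(n + 1).
  rw [Real.inv_rpow hpos.le, show (n : ℝ) + lam + 1 = lam + ((n + 1 : ℕ) : ℝ) by push_cast; ring,
    Real.rpow_add hpos, Real.rpow_natCast]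
  have := (Real.rpow_pos_of_pos hpos lam).ne'
  rw [one_div_pow]
  field_simp

/-! ### The Dirichlet integral and the constant c_λ -/

lemma lintegral_rpow_mul_exp_neg_mul_Ioi {a r : ℝ} (ha : 0 < a) (hr : 0 < r) :
    ∫⁻ x in Set.Ioi (0 : ℝ), ENNReal.ofReal (x ^ (a - 1) * Real.exp (-(r * x))) =
      ENNReal.ofReal ((1 / r) ^ a * Real.Gamma a) := by
  have h := Real.integral_rpow_mul_exp_neg_mul_Ioi ha hr
  have hpos : 0 < (1 / r) ^ a * Real.Gamma a :=
    mul_pos (Real.rpow_pos_of_pos (by positivity) _) (Real.Gamma_pos_of_pos ha)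
  rw [← h, ofReal_integral_eq_lintegral_ofReal]
  -- Integrability comes from the value: a non-integrable function would have Bochner integral 0,
  -- and this integral is positive.
  · exact not_imp_comm.1 integral_undef (by rw [h]; exact hpos.ne')
  · filter_upwards [ae_restrict_mem measurableSet_Ioi] with x hx
    exact mul_nonneg (Real.rpow_nonneg (le_of_lt hx) _) (Real.exp_nonneg _)

lemma lintegral_posOrthant_prod {n : ℕ} (g : Fin n → ℝ → ℝ)
    (hg : ∀ j, IntegrableOn (g j) (Set.Ioi 0)) (hg0 : ∀ j, ∀ x ∈ Set.Ioi (0 : ℝ), 0 ≤ g j x) :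
    ∫⁻ h in posOrthant n, ENNReal.ofReal (∏ j, g j (h j)) =
      ENNReal.ofReal (∏ j, ∫ x in Set.Ioi 0, g j x) := by
  have h1 : posOrthant n = Set.univ.pi fun _ => Set.Ioi 0 := by
    ext h; simp [posOrthant]
  have h2 : (volume : Measure (Fin n → ℝ)).restrict (posOrthant n) =
      Measure.pi fun _ => volume.restrict (Set.Ioi 0) := by
    rw [h1, volume_pi, Measure.restrict_pi_pi]
  rw [← integral_fintype_prod_eq_prod (μ := fun _ : Fin n => volume.restrict (Set.Ioi (0 : ℝ))),
    ← h2, ofReal_integral_eq_lintegral_ofReal]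
  · rw [h2]
    exact Integrable.fintype_prod hg
  · filter_upwards [ae_restrict_mem (measurableSet_posOrthant n)] with h hh
    exact Finset.prod_nonneg fun j _ => hg0 j _ (hh j)

lemma lintegral_posOrthant_pow_mul_exp {n : ℕ} (p : Fin n → ℕ) {x : ℝ} (hx : 0 < x) :
    ∫⁻ h in posOrthant n, ENNReal.ofReal (∏ j, (h j ^ p j * Real.exp (-(x * h j)))) =
      ENNReal.ofReal (mfact p * (1 / x) ^ (mlen p + n)) := by
  have key : ∀ j, ∫ y in Set.Ioi (0 : ℝ), y ^ p j * Real.exp (-(x * y)) =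
      (1 / x) ^ (p j + 1) * (p j).factorial := by
    intro j
    have h := Real.integral_rpow_mul_exp_neg_mul_Ioi (a := (p j : ℝ) + 1) (by positivity) hx
    simp only [add_sub_cancel_right, Real.rpow_natCast, Real.Gamma_nat_eq_factorial] at h
    rw [h, ← Nat.cast_succ, Real.rpow_natCast]
  rw [lintegral_posOrthant_prod (fun j y => y ^ p j * Real.exp (-(x * y)))]
  · simp_rw [key]
    rw [Finset.prod_mul_distrib, Finset.prod_pow_eq_pow_sum, Finset.sum_add_distrib, mul_comm]
    simp [mfact, mlen]
  · intro j
    refine not_imp_comm.1 integral_undef ?_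
    rw [key]
    positivity
  · intro j y hy
    exact mul_nonneg (pow_nonneg (le_of_lt hy) _) (Real.exp_nonneg _)

lemma mfact_pos {n : ℕ} (p : Fin n → ℕ) : 0 < mfact p :=
  Finset.prod_pos fun j _ => by positivity

/-- The Dirichlet integral over the positive orthant. -/
lemma lintegral_dirichlet {n : ℕ} {lam : ℝ} (hlam : -1 < lam) (p : Fin n → ℕ) :
    ∫⁻ h in posOrthant n,
      ENNReal.ofReal ((∏ j, h j ^ p j) / (1 + l1 h) ^ ((mlen p : ℝ) + n + lam + 1)) =
      ENNReal.ofReal (mfact p * Real.Gamma (lam + 1) / Real.Gamma ((mlen p : ℝ) + n + lam + 1)) := by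
  set s : ℝ := (mlen p : ℝ) + n + lam + 1 with hs
  have hs0 : 0 < s := by
    have h1 : (0 : ℝ) ≤ mlen p := Nat.cast_nonneg _
    have h2 : (0 : ℝ) ≤ n := Nat.cast_nonneg _
    linarith
  have hl1 : Measurable (l1 : (Fin n → ℝ) → ℝ) := measurable_l1
  have hG : 0 < Real.Gamma s := Real.Gamma_pos_of_pos hs0
  -- Gamma function trick: Γ(s)(1 + ‖h‖₁)^{-s} = ∫ x^{s-1} e^{-(1+‖h‖₁)x} dx. After Tonelli the
  -- integral over h is a product of n one-variable Gamma integrals.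
  have hswap : ENNReal.ofReal (Real.Gamma s) * ∫⁻ h in posOrthant n,
      ENNReal.ofReal ((∏ j, h j ^ p j) / (1 + l1 h) ^ s) =
      ∫⁻ h in posOrthant n, ∫⁻ x in Set.Ioi (0 : ℝ),
        ENNReal.ofReal ((∏ j, h j ^ p j) * (x ^ (s - 1) * Real.exp (-((1 + l1 h) * x)))) := by
    rw [← lintegral_const_mul' _ _ ENNReal.ofReal_ne_top]
    refine setLIntegral_congr_fun (measurableSet_posOrthant n) fun h hh => ?_
    have hp : 0 ≤ ∏ j, h j ^ p j := Finset.prod_nonneg fun j _ => pow_nonneg (hh j).le _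
    have hpos := one_add_l1_pos h
    simp_rw [ENNReal.ofReal_mul hp]
    rw [lintegral_const_mul' _ _ ENNReal.ofReal_ne_top,
      lintegral_rpow_mul_exp_neg_mul_Ioi hs0 hpos, ← ENNReal.ofReal_mul hG.le,
      ← ENNReal.ofReal_mul hp, one_div, Real.inv_rpow hpos.le]
    congr 1
    ring
  -- The h-integral is p! x^{-(|p|+n)}, which lowers the exponent s - 1 to λ. It is written `lam + 1
  -- - 1` to match the integral defining Γ(λ+1).
  have hx : ∀ x ∈ Set.Ioi (0 : ℝ), ∫⁻ h in posOrthant n,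
      ENNReal.ofReal ((∏ j, h j ^ p j) * (x ^ (s - 1) * Real.exp (-((1 + l1 h) * x)))) =
      ENNReal.ofReal (mfact p) * ENNReal.ofReal (x ^ (lam + 1 - 1) * Real.exp (-(1 * x))) := by
    intro x hx
    have hx' : 0 < x := hx
    have e : ∀ h ∈ posOrthant n,
        ENNReal.ofReal ((∏ j, h j ^ p j) * (x ^ (s - 1) * Real.exp (-((1 + l1 h) * x)))) =
        ENNReal.ofReal (x ^ (s - 1) * Real.exp (-x)) *
          ENNReal.ofReal (∏ j, (h j ^ p j * Real.exp (-(x * h j)))) := by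
      intro h hh
      rw [← ENNReal.ofReal_mul (by positivity), Finset.prod_mul_distrib, ← Real.exp_sum, l1_eq_sum hh]
      congr 1
      have : -((1 + ∑ j, h j) * x) = -x + ∑ j, -(x * h j) := by
        rw [Finset.sum_neg_distrib, ← Finset.mul_sum]; ring
      rw [this, Real.exp_add]
      ring
    rw [setLIntegral_congr_fun (measurableSet_posOrthant n) e,
      lintegral_const_mul' _ _ ENNReal.ofReal_ne_top, lintegral_posOrthant_pow_mul_exp p hx',
      ← ENNReal.ofReal_mul (by positivity), ← ENNReal.ofReal_mul (mfact_pos p).le]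
    congr 1
    have : x ^ (s - 1) = x ^ (lam + 1 - 1) * x ^ (mlen p + n) := by
      rw [← Real.rpow_natCast, ← Real.rpow_add hx']
      congr 1
      rw [hs]; push_cast; ring
    rw [this, one_mul, one_div, inv_pow]
    field_simp
  rw [lintegral_lintegral_swap, setLIntegral_congr_fun measurableSet_Ioi hx,
    lintegral_const_mul' _ _ ENNReal.ofReal_ne_top,
    lintegral_rpow_mul_exp_neg_mul_Ioi (by linarith) one_pos, div_one, Real.one_rpow, one_mul,
    ← ENNReal.ofReal_mul (mfact_pos p).le] at hswap
  · rw [ENNReal.ofReal_div_of_pos hG, ENNReal.eq_div_iff (by simpa using hG) ENNReal.ofReal_ne_top]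
    exact hswap
  · refine Measurable.aemeasurable ?_
    unfold Function.uncurry
    fun_prop

lemma Gamma_add_natCast {x : ℝ} (hx : 0 < x) (m : ℕ) :
    Real.Gamma (x + m) = poch x m * Real.Gamma x := by
  induction m with
  | zero => simp [poch]
  | succ m ih =>
    have h : x + m ≠ 0 := by positivity
    rw [Nat.cast_succ, ← add_assoc, Real.Gamma_add_one h, ih, poch, poch, ascPochhammer_succ_right]
    simp
    ring

lemma poch_pos {x : ℝ} (hx : 0 < x) (m : ℕ) : 0 < poch x m := ascPochhammer_pos m x hx

lemma cconst_eq {n : ℕ} {lam : ℝ} (hlam : -1 < lam) :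
    cconst n lam = poch (lam + 1) n / Real.pi ^ n := by
  have h : 0 < Real.Gamma (lam + 1) := Real.Gamma_pos_of_pos (by linarith)
  rw [cconst, show (n : ℝ) + lam + 1 = lam + 1 + n by ring, Gamma_add_natCast (by linarith)]
  field_simp

/-! ### Characters of the torus and Bessel's inequality -/

lemma eLpNorm_two_sq {α E : Type*} [MeasurableSpace α] [NormedAddCommGroup E] (μ : Measure α)
    (f : α → E) : eLpNorm f 2 μ ^ 2 = ∫⁻ x, ‖f x‖ₑ ^ 2 ∂μ := by
  rw [eLpNorm_eq_lintegral_rpow_enorm_toReal two_ne_zero ENNReal.ofNat_ne_top,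
    ← ENNReal.rpow_natCast, ← ENNReal.rpow_mul]
  simp

lemma integral_zpow_arcMeasure (k : ℤ) :
    ∫ t, t ^ k ∂arcMeasure = if k = 0 then ((2 * Real.pi : ℝ) : ℂ) else 0 := by
  have hm : AEStronglyMeasurable (fun t : ℂ => t ^ k)
      ((volume.restrict (Set.Ioc (-Real.pi) Real.pi)).map
        fun θ : ℝ => Complex.exp (θ * Complex.I)) :=
    (by fun_prop : Measurable fun t : ℂ => t ^ k).aestronglyMeasurable
  rw [arcMeasure, integral_map measurable_cexp_ofReal_mul_I.aemeasurable hm,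
    ← intervalIntegral.integral_of_le (by linarith [Real.pi_pos])]
  split_ifs with hk
  · subst hk
    simp
    ring
  · have hk' : (k : ℂ) * Complex.I ≠ 0 := by simpa using hk
    have e : ∀ θ : ℝ, Complex.exp (θ * Complex.I) ^ k =
        Complex.exp ((k : ℂ) * Complex.I * θ) := by
      intro θ
      rw [← Complex.exp_int_mul]
      congr 1
      ring
    simp_rw [e]
    rw [integral_exp_mul_complex hk']
    have : Complex.exp ((k : ℂ) * Complex.I * (Real.pi : ℝ)) =
        Complex.exp ((k : ℂ) * Complex.I * ((-Real.pi : ℝ) : ℂ)) := by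
      rw [Complex.exp_eq_exp_iff_exists_int]
      exact ⟨k, by push_cast; ring⟩
    rw [this, sub_self, zero_div]

lemma integral_prod_zpow_torusMeasure {n : ℕ} (q : Fin n → ℤ) :
    ∫ t, ∏ j, t j ^ q j ∂torusMeasure n = if q = 0 then (((2 * Real.pi) ^ n : ℝ) : ℂ) else 0 := by
  rw [torusMeasure, integral_fintype_prod_eq_prod (fun j (t : ℂ) => t ^ q j)]
  simp_rw [integral_zpow_arcMeasure]
  split_ifs with hq
  · simp [hq]
  · obtain ⟨j, hj⟩ := Function.ne_iff.1 hq
    exact Finset.prod_eq_zero (Finset.mem_univ j) (if_neg hj)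

/-- The normalising constant `(2π)^{-n/2}`. -/
def torusConst (n : ℕ) : ℝ := 1 / (2 * Real.pi) ^ ((n : ℝ) / 2)

lemma torusConst_sq (n : ℕ) : torusConst n * torusConst n * (2 * Real.pi) ^ n = 1 := by
  have hpi : (0 : ℝ) < 2 * Real.pi := by positivity
  have h : (2 * Real.pi) ^ ((n : ℝ) / 2) * (2 * Real.pi) ^ ((n : ℝ) / 2) = (2 * Real.pi) ^ n := by
    rw [← Real.rpow_add hpi, ← Real.rpow_natCast]
    congr 1
    ring
  rw [torusConst, ← h]
  have := (Real.rpow_pos_of_pos hpi ((n : ℝ) / 2)).ne'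
  field_simp

lemma norm_prod_zpow_eq_one {n : ℕ} {t : Fin n → ℂ} (ht : ∀ j, ‖t j‖ = 1) (q : Fin n → ℤ) :
    ‖∏ j, t j ^ q j‖ = 1 := by
  simp [norm_prod, norm_zpow, ht]

lemma conj_prod_zpow {n : ℕ} {t : Fin n → ℂ} (ht : ∀ j, ‖t j‖ = 1) (q : Fin n → ℤ) :
    (starRingEnd ℂ) (∏ j, t j ^ q j) = ∏ j, t j ^ (-q j) := by
  rw [map_prod]
  refine Finset.prod_congr rfl fun j _ => ?_
  rw [map_zpow₀, zpow_neg, ← inv_zpow, Complex.inv_eq_conj (ht j)]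

lemma measurable_prod_zpow {n : ℕ} (q : Fin n → ℤ) :
    Measurable fun t : Fin n → ℂ => ∏ j, t j ^ q j := by fun_prop

/-- The normalised character `(2π)^{-n/2} t^q`. -/
def torusChar {n : ℕ} (q : Fin n → ℤ) (t : Fin n → ℂ) : ℂ :=
  (torusConst n : ℂ) * ∏ j, t j ^ q j

lemma memLp_torusChar {n : ℕ} (q : Fin n → ℤ) : MemLp (torusChar q) 2 (torusMeasure n) := by
  refine MemLp.of_bound ((measurable_prod_zpow q).const_mul _).aestronglyMeasurable
    |torusConst n| ?_
  filter_upwards [ae_norm_eq_one_torusMeasure n] with t ht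
  rw [torusChar, norm_mul, norm_prod_zpow_eq_one ht]
  simp

lemma inner_torusChar {n : ℕ} (q : Fin n → ℤ) {φ : (Fin n → ℂ) → ℂ}
    (hφ : MemLp φ 2 (torusMeasure n)) :
    inner ℂ ((memLp_torusChar q).toLp _) (hφ.toLp φ) =
      (torusConst n : ℂ) * ∫ t, φ t * ∏ j, t j ^ (-q j) ∂torusMeasure n := by
  rw [L2.inner_def, ← integral_const_mul]
  refine integral_congr_ae ?_
  filter_upwards [ae_norm_eq_one_torusMeasure n, (memLp_torusChar q).coeFn_toLp,
    hφ.coeFn_toLp] with t ht h1 h2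
  rw [h1, h2, torusChar, ← conj_prod_zpow ht]
  simp
  ring

lemma orthonormal_torusChar (n : ℕ) :
    Orthonormal ℂ fun q : Fin n → ℤ => (memLp_torusChar q).toLp (torusChar q) := by
  rw [orthonormal_iff_ite]
  intro q q'
  rw [inner_torusChar]
  have h : ∫ t, torusChar q' t * ∏ j, t j ^ (-q j) ∂torusMeasure n =
      (torusConst n : ℂ) * ∫ t, ∏ j, t j ^ ((q' - q) j) ∂torusMeasure n := by
    rw [← integral_const_mul]
    refine integral_congr_ae ?_
    filter_upwards [ae_norm_eq_one_torusMeasure n] with t ht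
    rw [torusChar, mul_assoc, ← Finset.prod_mul_distrib]
    congr 1
    refine Finset.prod_congr rfl fun j _ => ?_
    have : t j ≠ 0 := by
      rw [← norm_ne_zero_iff, ht]; exact one_ne_zero
    rw [← zpow_add₀ this]
    rfl
  rw [h, integral_prod_zpow_torusMeasure]
  simp only [sub_eq_zero, eq_comm (a := q')]
  split_ifs
  · have := torusConst_sq n
    rw [← mul_assoc]
    exact_mod_cast this
  · simp

/-- Bessel's inequality for the characters of the torus. -/
lemma tsum_enorm_fourier_sq_le {n : ℕ} {φ : (Fin n → ℂ) → ℂ} (hφ : MemLp φ 2 (torusMeasure n)) :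
    ∑' q : Fin n → ℤ, ‖(torusConst n : ℂ) * ∫ t, φ t * ∏ j, t j ^ (-q j) ∂torusMeasure n‖ₑ ^ 2 ≤
      ∫⁻ t, ‖φ t‖ₑ ^ 2 ∂torusMeasure n := by
  have hb : ∀ s : Finset (Fin n → ℤ), ∑ q ∈ s,
      ‖(torusConst n : ℂ) * ∫ t, φ t * ∏ j, t j ^ (-q j) ∂torusMeasure n‖ₑ ^ 2 ≤
      ∫⁻ t, ‖φ t‖ₑ ^ 2 ∂torusMeasure n := by
    intro s
    have h := (orthonormal_torusChar n).sum_inner_products_le (hφ.toLp φ) (s := s)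
    simp_rw [inner_torusChar] at h
    have h2 := ENNReal.ofReal_le_ofReal h
    rw [ENNReal.ofReal_sum_of_nonneg (fun _ _ => by positivity)] at h2
    simp_rw [ENNReal.ofReal_pow (norm_nonneg _), ofReal_norm] at h2
    rwa [Lp.enorm_toLp, eLpNorm_two_sq] at h2
  rw [ENNReal.tsum_eq_iSup_sum]
  exact iSup_le hb

/-! ### The fibrewise Fourier transform U₁ -/

instance sFinite_nuTilde (n : ℕ) (lam : ℝ) : SFinite (nuTilde n lam) := by
  unfold nuTilde
  infer_instance

/-- The fibrewise Fourier coefficients `(2π)^{-n/2} ∫ φ(t, h) t^{-q} dt / (i t)`. -/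
def fourierFiber {n : ℕ} (φ : (Fin n → ℂ) × (Fin n → ℝ) → ℂ) (q : Fin n → ℤ)
    (h : Fin n → ℝ) : ℂ :=
  (torusConst n : ℂ) * ∫ t, φ (t, h) * ∏ j, t j ^ (-q j) ∂torusMeasure n

section fourierFiber

variable {n : ℕ} {lam : ℝ}

/-- The factors of ν_λ are exchanged because Fourier integrals run over t at fixed h, so h has to be
the outer variable. -/
lemma ae_ae_of_ae_nu {P : (Fin n → ℂ) × (Fin n → ℝ) → Prop} (hP : ∀ᵐ x ∂nu n lam, P x) :
    ∀ᵐ h ∂nuTilde n lam, ∀ᵐ t ∂torusMeasure n, P (t, h) := by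
  have h1 : ∀ᵐ x ∂(nuTilde n lam).prod (torusMeasure n), P x.swap :=
    (Measure.measurePreserving_swap (μ := nuTilde n lam)
      (ν := torusMeasure n)).quasiMeasurePreserving.ae hP
  exact Measure.ae_ae_of_ae_prod h1

/-- By Tonelli the function h ↦ ‖φ(·, h)‖² has finite integral, hence is finite almost everywhere.
-/
lemma ae_memLp_fiber {φ : (Fin n → ℂ) × (Fin n → ℝ) → ℂ} (hφ : MemLp φ 2 (nu n lam)) :
    ∀ᵐ h ∂nuTilde n lam, MemLp (fun t => φ (t, h)) 2 (torusMeasure n) := by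
  have hsw : AEStronglyMeasurable (fun x : (Fin n → ℝ) × (Fin n → ℂ) => φ x.swap)
      ((nuTilde n lam).prod (torusMeasure n)) := hφ.1.prod_swap
  have hm : AEMeasurable (fun x => ‖φ x‖ₑ ^ 2) (nu n lam) := hφ.1.enorm.pow_const 2
  have hfin : ∫⁻ h, ∫⁻ t, ‖φ (t, h)‖ₑ ^ 2 ∂torusMeasure n ∂nuTilde n lam ≠ ∞ := by
    rw [← lintegral_prod_symm _ hm]
    change ∫⁻ x, ‖φ x‖ₑ ^ 2 ∂nu n lam ≠ ∞
    rw [← eLpNorm_two_sq]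
    exact ENNReal.pow_ne_top hφ.2.ne
  have hm' : AEMeasurable (fun h => ∫⁻ t, ‖φ (t, h)‖ₑ ^ 2 ∂torusMeasure n) (nuTilde n lam) :=
    AEMeasurable.lintegral_prod_right' (f := fun x : (Fin n → ℝ) × (Fin n → ℂ) => ‖φ x.swap‖ₑ ^ 2)
      (hsw.enorm.pow_const 2)
  filter_upwards [hsw.prodMk_left, ae_lt_top' hm' hfin] with h h1 h2
  refine ⟨h1, ?_⟩
  rw [← eLpNorm_two_sq] at h2
  by_contra hcon
  rw [not_lt, top_le_iff] at hcon
  simp [hcon] at h2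

lemma aestronglyMeasurable_fourierFiber {φ : (Fin n → ℂ) × (Fin n → ℝ) → ℂ}
    (hφ : MemLp φ 2 (nu n lam)) (q : Fin n → ℤ) :
    AEStronglyMeasurable (fourierFiber φ q) (nuTilde n lam) := by
  have hsw : AEStronglyMeasurable (fun x : (Fin n → ℝ) × (Fin n → ℂ) => φ x.swap)
      ((nuTilde n lam).prod (torusMeasure n)) := hφ.1.prod_swap
  have hc : AEStronglyMeasurable (fun x : (Fin n → ℝ) × (Fin n → ℂ) => ∏ j, x.2 j ^ (-q j))
      ((nuTilde n lam).prod (torusMeasure n)) :=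
    (by fun_prop : Measurable fun x : (Fin n → ℝ) × (Fin n → ℂ) =>
      ∏ j, x.2 j ^ (-q j)).aestronglyMeasurable
  exact (hsw.mul hc).integral_prod_right'.const_mul _

/-- Bessel's inequality in each fibre, integrated over h. The inequality is enough: it makes U₁ well
defined and bounded, and the argument never needs U₁ to be isometric. -/
lemma lintegral_tsum_fourierFiber_le {φ : (Fin n → ℂ) × (Fin n → ℝ) → ℂ}
    (hφ : MemLp φ 2 (nu n lam)) :
    ∑' q : Fin n → ℤ, eLpNorm (fourierFiber φ q) 2 (nuTilde n lam) ^ 2 ≤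
      eLpNorm φ 2 (nu n lam) ^ 2 := by
  have hm : AEMeasurable (fun x => ‖φ x‖ₑ ^ 2) (nu n lam) := hφ.1.enorm.pow_const 2
  simp_rw [eLpNorm_two_sq]
  rw [← lintegral_tsum fun q => (aestronglyMeasurable_fourierFiber hφ q).enorm.pow_const 2]
  have e : ∫⁻ x, ‖φ x‖ₑ ^ 2 ∂nu n lam =
      ∫⁻ h, ∫⁻ t, ‖φ (t, h)‖ₑ ^ 2 ∂torusMeasure n ∂nuTilde n lam :=
    lintegral_prod_symm _ hm
  rw [e]
  refine lintegral_mono_ae ?_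
  filter_upwards [ae_memLp_fiber hφ] with h hh
  exact tsum_enorm_fourier_sq_le hh

lemma memLp_fourierFiber {φ : (Fin n → ℂ) × (Fin n → ℝ) → ℂ} (hφ : MemLp φ 2 (nu n lam))
    (q : Fin n → ℤ) : MemLp (fourierFiber φ q) 2 (nuTilde n lam) := by
  refine ⟨aestronglyMeasurable_fourierFiber hφ q, ?_⟩
  have h1 := (ENNReal.le_tsum q).trans (lintegral_tsum_fourierFiber_le hφ)
  have h2 := lt_of_le_of_lt h1 (ENNReal.pow_ne_top hφ.2.ne).lt_top
  by_contra hcon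
  rw [not_lt, top_le_iff] at hcon
  simp [hcon] at h2

lemma integrable_fiber_mul {φ : (Fin n → ℂ) → ℂ} (hφ : MemLp φ 2 (torusMeasure n))
    (q : Fin n → ℤ) : Integrable (fun t => φ t * ∏ j, t j ^ q j) (torusMeasure n) := by
  refine (hφ.integrable one_le_two).mul_bdd (c := 1)
    (measurable_prod_zpow q).aestronglyMeasurable ?_
  filter_upwards [ae_norm_eq_one_torusMeasure n] with t ht
  exact (norm_prod_zpow_eq_one ht q).le

lemma fourierFiber_congr {φ ψ : (Fin n → ℂ) × (Fin n → ℝ) → ℂ} (h : φ =ᵐ[nu n lam] ψ)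
    (q : Fin n → ℤ) : fourierFiber φ q =ᵐ[nuTilde n lam] fourierFiber ψ q := by
  filter_upwards [ae_ae_of_ae_nu h] with x hx
  rw [fourierFiber, fourierFiber]
  congr 1
  refine integral_congr_ae ?_
  filter_upwards [hx] with t ht
  rw [ht]

lemma fourierFiber_add {φ ψ : (Fin n → ℂ) × (Fin n → ℝ) → ℂ} (hφ : MemLp φ 2 (nu n lam))
    (hψ : MemLp ψ 2 (nu n lam)) (q : Fin n → ℤ) :
    fourierFiber (φ + ψ) q =ᵐ[nuTilde n lam] fourierFiber φ q + fourierFiber ψ q := by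
  filter_upwards [ae_memLp_fiber hφ, ae_memLp_fiber hψ] with h h1 h2
  have e := integral_add (integrable_fiber_mul h1 (fun j => -q j))
    (integrable_fiber_mul h2 (fun j => -q j))
  simp only [fourierFiber, Pi.add_apply, add_mul]
  rw [e, mul_add]

lemma fourierFiber_smul (c : ℂ) (φ : (Fin n → ℂ) × (Fin n → ℝ) → ℂ) (q : Fin n → ℤ) :
    fourierFiber (c • φ) q = c • fourierFiber φ q := by
  ext h
  simp only [fourierFiber, Pi.smul_apply, smul_eq_mul, mul_assoc]
  rw [integral_const_mul]
  ring

/-- The fibrewise Fourier coefficient of an `L²` class, as an `L²` class. -/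
def fourierCoord (φ : Lp ℂ 2 (nu n lam)) (q : Fin n → ℤ) : Lp ℂ 2 (nuTilde n lam) :=
  (memLp_fourierFiber (Lp.memLp φ) q).toLp

lemma fourierCoord_add (φ ψ : Lp ℂ 2 (nu n lam)) (q : Fin n → ℤ) :
    fourierCoord (φ + ψ) q = fourierCoord φ q + fourierCoord ψ q := by
  rw [fourierCoord, fourierCoord, fourierCoord, ← MemLp.toLp_add, MemLp.toLp_eq_toLp_iff]
  exact (fourierFiber_congr (Lp.coeFn_add φ ψ) q).trans
    (fourierFiber_add (Lp.memLp φ) (Lp.memLp ψ) q)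

lemma fourierCoord_smul (c : ℂ) (φ : Lp ℂ 2 (nu n lam)) (q : Fin n → ℤ) :
    fourierCoord (c • φ) q = c • fourierCoord φ q := by
  rw [fourierCoord, fourierCoord, ← MemLp.toLp_const_smul, MemLp.toLp_eq_toLp_iff]
  refine (fourierFiber_congr (Lp.coeFn_smul c φ) q).trans ?_
  rw [fourierFiber_smul]

lemma sum_norm_fourierCoord_le (φ : Lp ℂ 2 (nu n lam)) (s : Finset (Fin n → ℤ)) :
    ∑ q ∈ s, ‖fourierCoord φ q‖ ^ (2 : ℝ≥0∞).toReal ≤ ‖φ‖ ^ (2 : ℝ≥0∞).toReal := by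
  simp only [ENNReal.toReal_ofNat, Real.rpow_ofNat]
  rw [← ENNReal.ofReal_le_ofReal_iff (by positivity),
    ENNReal.ofReal_sum_of_nonneg (fun _ _ => by positivity)]
  simp_rw [ENNReal.ofReal_pow (norm_nonneg _), ofReal_norm, fourierCoord, Lp.enorm_toLp,
    Lp.enorm_def]
  exact (ENNReal.sum_le_tsum s).trans (lintegral_tsum_fourierFiber_le (Lp.memLp φ))

/-- The fibrewise Fourier transform as an operator into `ℓ²(ℤⁿ, L²(ℝⁿ₊, ν̃_λ))`. -/
def fourierOp (n : ℕ) (lam : ℝ) : Lp ℂ 2 (nu n lam) →L[ℂ] ell2L2 n lam :=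
  LinearMap.mkContinuous
    { toFun := fun φ => ⟨fourierCoord φ, memℓp_gen' (sum_norm_fourierCoord_le φ)⟩
      map_add' := fun φ ψ => Subtype.ext (funext (fourierCoord_add φ ψ))
      map_smul' := fun c φ => Subtype.ext (funext (fourierCoord_smul c φ)) }
    1 fun φ => by
      rw [one_mul]
      exact lp.norm_le_of_forall_sum_le (by norm_num) (norm_nonneg _) (sum_norm_fourierCoord_le φ)

lemma coeFn_fourierOp (φ : Lp ℂ 2 (nu n lam)) (q : Fin n → ℤ) :
    fourierOp n lam φ q =ᵐ[nuTilde n lam] fourierFiber φ q :=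
  (memLp_fourierFiber (Lp.memLp φ) q).coeFn_toLp

lemma isU₁_fourierOp : IsU₁ (fourierOp n lam) := fun φ q => coeFn_fourierOp φ q

end fourierFiber

/-! ### The radial profiles and the operator W_λ -/

section radial

variable {n : ℕ} {lam : ℝ}

/-- The constant `(2π)ⁿ (n + λ + 1)_{|p|} / (p! (λ + 1)_n)`. -/
def radialConst (lam : ℝ) (p : Fin n → ℕ) : ℝ :=
  (2 * Real.pi) ^ n * poch (n + lam + 1) (mlen p) / (mfact p * poch (lam + 1) n)

/-- The radial profile `√C_p h^{p/2} (1 + ‖h‖₁)^{-|p|/2}`. -/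
def radial (lam : ℝ) (p : Fin n → ℕ) (h : Fin n → ℝ) : ℝ :=
  √(radialConst lam p) * ((∏ j, h j ^ ((p j : ℝ) / 2)) / (1 + l1 h) ^ ((mlen p : ℝ) / 2))

lemma natCast_add_pos (n : ℕ) (hlam : -1 < lam) : 0 < (n : ℝ) + lam + 1 := by
  have : (0 : ℝ) ≤ n := n.cast_nonneg
  linarith

lemma poch_lam_pos (hlam : -1 < lam) : 0 < poch (lam + 1) n := poch_pos (by linarith) n

lemma radialConst_pos (hlam : -1 < lam) (p : Fin n → ℕ) : 0 < radialConst lam p := by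
  have h1 := poch_pos (natCast_add_pos n hlam) (mlen p)
  have h2 := poch_lam_pos (n := n) hlam
  have h3 := mfact_pos p
  unfold radialConst
  positivity

/-- Since c_λ = (λ+1)_n/πⁿ, the Pochhammer symbols (λ+1)_n and the powers of 2π cancel, leaving the
prefactor of γ. -/
lemma radialConst_mul_cconst (hlam : -1 < lam) (p : Fin n → ℕ) :
    radialConst lam p * (cconst n lam / 2 ^ n) = poch (n + lam + 1) (mlen p) / mfact p := by
  have h2 := poch_lam_pos (n := n) hlam
  have h3 := mfact_pos p
  rw [radialConst, cconst_eq hlam, mul_pow]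
  field_simp

lemma measurable_radial (p : Fin n → ℕ) : Measurable (radial lam p) := by
  have hl1 : Measurable (l1 : (Fin n → ℝ) → ℝ) := measurable_l1
  unfold radial
  fun_prop

lemma radial_sq (hlam : -1 < lam) (p : Fin n → ℕ) {h : Fin n → ℝ} (hh : h ∈ posOrthant n) :
    radial lam p h ^ 2 = radialConst lam p * ((∏ j, h j ^ p j) / (1 + l1 h) ^ (mlen p : ℝ)) := by
  have hpos := one_add_l1_pos h
  rw [radial, mul_pow, Real.sq_sqrt (radialConst_pos hlam p).le, div_pow, ← Finset.prod_pow,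
    ← Real.rpow_mul_natCast hpos.le]
  congr 2
  · refine Finset.prod_congr rfl fun j _ => ?_
    rw [← Real.rpow_mul_natCast (hh j).le, Nat.cast_ofNat, div_mul_cancel₀ _ two_ne_zero,
      Real.rpow_natCast]
  · simp

/-- The density of `ν̃_λ`. -/
def nuDensity (lam : ℝ) (h : Fin n → ℝ) : ℝ :=
  cconst n lam / (2 ^ n * (1 + l1 h) ^ ((n : ℝ) + lam + 1))

lemma measurable_nuDensity : Measurable (nuDensity lam : (Fin n → ℝ) → ℝ) := by
  have hl1 : Measurable (l1 : (Fin n → ℝ) → ℝ) := measurable_l1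
  unfold nuDensity
  fun_prop

lemma nuDensity_pos (hlam : -1 < lam) (h : Fin n → ℝ) : 0 < nuDensity lam h := by
  have h1 := cconst_pos (n := n) hlam
  have h2 := one_add_l1_pos h
  unfold nuDensity
  positivity

/-- The right side is the prefactor of γ(p) times the kernel that multiplies f in its integrand.
Both the norms of the profiles and the values γ(p) are read off from this identity. -/
lemma nuDensity_mul_radial_sq (hlam : -1 < lam) (p : Fin n → ℕ) {h : Fin n → ℝ}
    (hh : h ∈ posOrthant n) :
    nuDensity lam h * radial lam p h ^ 2 = poch (n + lam + 1) (mlen p) / mfact p *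
      ((∏ j, h j ^ p j) / (1 + l1 h) ^ ((mlen p : ℝ) + n + lam + 1)) := by
  have hpos := one_add_l1_pos h
  have e : (mlen p : ℝ) + n + lam + 1 = (mlen p : ℝ) + (n + lam + 1) := by ring
  rw [radial_sq hlam p hh, ← radialConst_mul_cconst hlam, nuDensity, e,
    Real.rpow_add hpos (mlen p : ℝ)]
  have h1 := (Real.rpow_pos_of_pos hpos (mlen p : ℝ)).ne'
  have h2 := (Real.rpow_pos_of_pos hpos ((n : ℝ) + lam + 1)).ne'
  generalize (1 + l1 h) ^ ((n : ℝ) + lam + 1) = y at h2 ⊢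
  field_simp

lemma ae_mem_posOrthant : ∀ᵐ h ∂nuTilde n lam, h ∈ posOrthant n :=
  (withDensity_absolutelyContinuous _ _).ae_le (ae_restrict_mem (measurableSet_posOrthant n))

/-- By the Dirichlet integral the p! cancels and the rest is Γ(λ+1)/Γ(n+λ+1). The value does not
depend on p, so W_λ is a constant multiple of an isometry and one scalar √(λ+1)_n normalises
everything. -/
lemma lintegral_radial_sq (hlam : -1 < lam) (p : Fin n → ℕ) :
    ∫⁻ h, ‖(radial lam p h : ℂ)‖ₑ ^ 2 ∂nuTilde n lam = ENNReal.ofReal (poch (lam + 1) n)⁻¹ := by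
  have hm : Measurable fun h : Fin n → ℝ => ‖(radial lam p h : ℂ)‖ₑ ^ 2 := by
    have := measurable_radial (lam := lam) p
    fun_prop
  have hpp := poch_pos (natCast_add_pos n hlam) (mlen p)
  have hP := poch_lam_pos (n := n) hlam
  have hf := mfact_pos p
  have hG : 0 < Real.Gamma (lam + 1) := Real.Gamma_pos_of_pos (by linarith)
  have h1 : ∫⁻ h, ‖(radial lam p h : ℂ)‖ₑ ^ 2 ∂nuTilde n lam =
      ∫⁻ h in posOrthant n, ENNReal.ofReal (nuDensity lam h) * ‖(radial lam p h : ℂ)‖ₑ ^ 2 :=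
    lintegral_withDensity_eq_lintegral_mul _ measurable_nuDensity.ennreal_ofReal hm
  have h2 : ∀ h ∈ posOrthant n,
      ENNReal.ofReal (nuDensity lam h) * ‖(radial lam p h : ℂ)‖ₑ ^ 2 =
      ENNReal.ofReal (poch (n + lam + 1) (mlen p) / mfact p) *
        ENNReal.ofReal ((∏ j, h j ^ p j) / (1 + l1 h) ^ ((mlen p : ℝ) + n + lam + 1)) := by
    intro h hh
    rw [← ENNReal.ofReal_mul (by positivity), ← nuDensity_mul_radial_sq hlam p hh,
      ENNReal.ofReal_mul (nuDensity_pos hlam h).le, ← ofReal_norm, Complex.norm_real,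
      ← ENNReal.ofReal_pow (norm_nonneg _), Real.norm_eq_abs, sq_abs]
  rw [h1, setLIntegral_congr_fun (measurableSet_posOrthant n) h2,
    lintegral_const_mul' _ _ ENNReal.ofReal_ne_top, lintegral_dirichlet hlam,
    ← ENNReal.ofReal_mul (by positivity)]
  congr 1
  rw [show (mlen p : ℝ) + n + lam + 1 = (n + lam + 1) + mlen p by ring,
    Gamma_add_natCast (natCast_add_pos n hlam), show (n : ℝ) + lam + 1 = lam + 1 + n by ring,
    Gamma_add_natCast (x := lam + 1) (by linarith)]
  rw [show (n : ℝ) + lam + 1 = lam + 1 + n by ring] at hpp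
  field_simp

lemma memLp_radial (hlam : -1 < lam) (p : Fin n → ℕ) :
    MemLp (fun h => (radial lam p h : ℂ)) 2 (nuTilde n lam) := by
  refine ⟨(measurable_radial p).complex_ofReal.aestronglyMeasurable, ?_⟩
  have h := lintegral_radial_sq hlam p
  rw [← eLpNorm_two_sq] at h
  by_contra hcon
  rw [not_lt, top_le_iff] at hcon
  simp [hcon] at h

/-- The radial profile as an element of `L²(ℝⁿ₊, ν̃_λ)`. -/
def radialLp (hlam : -1 < lam) (p : Fin n → ℕ) : Lp ℂ 2 (nuTilde n lam) :=
  (memLp_radial hlam p).toLp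

lemma norm_radialLp_sq (hlam : -1 < lam) (p : Fin n → ℕ) :
    ‖radialLp hlam p‖ ^ 2 = (poch (lam + 1) n)⁻¹ := by
  have hP := poch_lam_pos (n := n) hlam
  have h := lintegral_radial_sq hlam p
  rw [← eLpNorm_two_sq, ← Lp.enorm_toLp (memLp_radial hlam p), ← ofReal_norm,
    ← ENNReal.ofReal_pow (norm_nonneg _)] at h
  exact (ENNReal.ofReal_eq_ofReal_iff (by positivity) (by positivity)).1 h

lemma natCast_multiIndex_injective :
    Function.Injective fun (p : Fin n → ℕ) (j : Fin n) => (p j : ℤ) := by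
  intro p q h
  ext j
  simpa using congrFun h j

/-- The normalised radial profiles placed at the multi-indices `p ∈ ℤⁿ₊`. -/
def radialVec (hlam : -1 < lam) (p : Fin n → ℕ) : ell2L2 n lam :=
  lp.single 2 (fun j => (p j : ℤ)) (((√(poch (lam + 1) n) : ℝ) : ℂ) • radialLp hlam p)

/-- Distinct vectors sit at distinct indices of ℤⁿ, so no orthogonality of the profiles themselves
is involved. -/
lemma orthonormal_radialVec (hlam : -1 < lam) :
    Orthonormal ℂ (radialVec (n := n) hlam) := by
  have hP := poch_lam_pos (n := n) hlam
  constructor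
  · intro p
    rw [radialVec, lp.norm_single (by norm_num), norm_smul, Complex.norm_real, Real.norm_eq_abs,
      ← sq_eq_sq₀ (by positivity) zero_le_one, mul_pow, norm_radialLp_sq, sq_abs,
      Real.sq_sqrt hP.le, mul_inv_cancel₀ hP.ne', one_pow]
  · intro p q hpq
    rw [radialVec, radialVec, lp.inner_single_left, lp.single_apply_ne, inner_zero_right]
    exact fun h => hpq (natCast_multiIndex_injective h)

/-- The operator `W_λ`. -/
def radialOp (hlam : -1 < lam) : ell2 n →L[ℂ] ell2L2 n lam :=
  (((√(poch (lam + 1) n))⁻¹ : ℝ) : ℂ) •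
    (orthonormal_radialVec hlam).orthogonalFamily.linearIsometry.toContinuousLinearMap

lemma hasSum_radialOp (hlam : -1 < lam) (ψ : ell2 n) (q : Fin n → ℤ) :
    HasSum (fun p => (((√(poch (lam + 1) n))⁻¹ : ℝ) : ℂ) • ψ p • radialVec hlam p q)
      (radialOp hlam ψ q) := by
  have h1 := (orthonormal_radialVec (n := n) hlam).orthogonalFamily.hasSum_linearIsometry ψ
  have h2 := h1.mapL (lp.evalCLM ℂ (fun _ : Fin n → ℤ => Lp ℂ 2 (nuTilde n lam)) 2 q)
  exact h2.const_smul (((√(poch (lam + 1) n))⁻¹ : ℝ) : ℂ)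

lemma radialOp_apply_natCast (hlam : -1 < lam) (ψ : ell2 n) (p : Fin n → ℕ) :
    radialOp hlam ψ (fun j => (p j : ℤ)) = ψ p • radialLp hlam p := by
  have hP := Real.sqrt_pos.2 (poch_lam_pos (n := n) hlam)
  refine (hasSum_radialOp hlam ψ _).unique ?_
  convert hasSum_single p ?_ using 1
  · rw [radialVec, lp.single_apply_self, smul_smul, smul_smul, mul_right_comm,
      ← Complex.ofReal_mul, inv_mul_cancel₀ hP.ne', Complex.ofReal_one, one_mul]
  · intro p' hp'
    rw [radialVec, lp.single_apply_ne, smul_zero, smul_zero]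
    exact fun h => hp' (natCast_multiIndex_injective h).symm

lemma radialOp_apply_of_neg (hlam : -1 < lam) (ψ : ell2 n) (q : Fin n → ℤ) (hq : ∃ j, q j < 0) :
    radialOp hlam ψ q = 0 := by
  refine (hasSum_radialOp hlam ψ q).unique ?_
  convert hasSum_zero using 1
  funext p
  obtain ⟨j, hj⟩ := hq
  rw [radialVec, lp.single_apply_ne, smul_zero, smul_zero]
  intro h
  rw [h] at hj
  exact absurd hj (not_lt.2 (Int.natCast_nonneg _))

lemma isW_radialOp (hlam : -1 < lam) : IsW (radialOp (n := n) hlam) := by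
  refine fun ψ => ⟨fun p => ?_, fun q hq => radialOp_apply_of_neg hlam ψ q hq⟩
  rw [radialOp_apply_natCast]
  filter_upwards [Lp.coeFn_smul (ψ p) (radialLp hlam p), (memLp_radial hlam p).coeFn_toLp]
    with h h1 h2
  rw [h1, Pi.smul_apply, radialLp, h2, smul_eq_mul, mul_comm]
  rfl

/-- Pairing with these images of the standard basis computes the coordinates of W_λ^*. -/
lemma radialOp_single (hlam : -1 < lam) (p : Fin n → ℕ) :
    radialOp hlam (lp.single 2 p 1) = lp.single 2 (fun j => (p j : ℤ)) (radialLp hlam p) := by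
  have hP := Real.sqrt_pos.2 (poch_lam_pos (n := n) hlam)
  rw [radialOp, smul_apply, LinearIsometry.coe_toContinuousLinearMap,
    OrthogonalFamily.linearIsometry_apply_single, LinearIsometry.toSpanSingleton_apply, one_smul,
    radialVec, ← lp.single_smul, smul_smul, ← Complex.ofReal_mul, inv_mul_cancel₀ hP.ne',
    Complex.ofReal_one, one_smul]

end radial

/-! ### Monomials and the matrix of multiplication by the symbol -/

section monomial

variable {n : ℕ} {lam : ℝ}

/-- The monomial `√(C_p / (2π)ⁿ) z^p`. -/
def monoFun (lam : ℝ) (p : Fin n → ℕ) (z : Fin n → ℂ) : ℂ :=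
  ((torusConst n * √(radialConst lam p) : ℝ) : ℂ) * ∏ j, z j ^ p j

lemma measurable_monoFun (p : Fin n → ℕ) : Measurable (monoFun lam p) := by
  unfold monoFun
  fun_prop

lemma differentiable_monoFun (p : Fin n → ℕ) : Differentiable ℂ (monoFun lam p) := by
  unfold monoFun
  exact Differentiable.const_mul (by fun_prop) _

/-- Separation of variables: the denominators (1 + ‖h‖₁)^{1/2} in κ multiply up to (1 +
‖h‖₁)^{|p|/2}, so the monomial is a normalised character in t times the profile used by W_λ. -/
lemma monoFun_kappa (p : Fin n → ℕ) (t : Fin n → ℂ) {h : Fin n → ℝ} (hh : h ∈ posOrthant n) :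
    monoFun lam p (kappa n (t, h)) =
      torusChar (fun j => (p j : ℤ)) t * (radial lam p h : ℂ) := by
  have hpos := one_add_l1_pos h
  have e1 : ∏ j, kappa n (t, h) j ^ p j = (∏ j, t j ^ (p j : ℤ)) *
      (((∏ j, h j ^ ((p j : ℝ) / 2)) / (1 + l1 h) ^ ((mlen p : ℝ) / 2) : ℝ) : ℂ) := by
    have e2 : (1 + l1 h) ^ ((mlen p : ℝ) / 2) = ∏ j, ((1 + l1 h) ^ (1 / 2 : ℝ)) ^ p j := by
      rw [Finset.prod_pow_eq_pow_sum, ← Real.rpow_mul_natCast hpos.le]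
      congr 1
      rw [mlen]
      ring
    have e3 : ∀ j, h j ^ ((p j : ℝ) / 2) = (h j ^ (1 / 2 : ℝ)) ^ p j := by
      intro j
      rw [← Real.rpow_mul_natCast (hh j).le]
      congr 1
      ring
    rw [e2, ← Finset.prod_div_distrib]
    push_cast
    rw [← Finset.prod_mul_distrib]
    refine Finset.prod_congr rfl fun j _ => ?_
    rw [e3, kappa, zpow_natCast]
    push_cast
    ring
  rw [monoFun, e1, torusChar, radial]
  push_cast
  ring

lemma ae_nu : ∀ᵐ x ∂nu n lam, (∀ j, ‖x.1 j‖ = 1) ∧ x.2 ∈ posOrthant n :=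
  (Measure.quasiMeasurePreserving_fst.ae (ae_norm_eq_one_torusMeasure n)).and
    (Measure.quasiMeasurePreserving_snd.ae ae_mem_posOrthant)

lemma monoFun_kappa_ae (p : Fin n → ℕ) : (fun x => monoFun lam p (kappa n x)) =ᵐ[nu n lam]
    fun x => torusChar (fun j => (p j : ℤ)) x.1 * (radial lam p x.2 : ℂ) := by
  filter_upwards [ae_nu] with x hx
  exact monoFun_kappa p x.1 hx.2

lemma memLp_monoFun (hlam : -1 < lam) (p : Fin n → ℕ) :
    MemLp (monoFun lam p) 2 (ballMeasure n lam) := by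
  have hmp := measurePreserving_kappa n hlam
  refine ⟨(measurable_monoFun p).aestronglyMeasurable, ?_⟩
  have h1 : eLpNorm (monoFun lam p) 2 (ballMeasure n lam) ^ 2 =
      eLpNorm (torusChar fun j => (p j : ℤ)) 2 (torusMeasure n) ^ 2 *
        eLpNorm (fun h => (radial lam p h : ℂ)) 2 (nuTilde n lam) ^ 2 := by
    rw [← eLpNorm_comp_measurePreserving (measurable_monoFun p).aestronglyMeasurable hmp,
      eLpNorm_congr_ae (show monoFun lam p ∘ kappa n =ᵐ[nu n lam] _ from monoFun_kappa_ae p),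
      eLpNorm_two_sq, eLpNorm_two_sq, eLpNorm_two_sq,
      ← lintegral_prod_mul]
    · refine lintegral_congr fun x => ?_
      rw [enorm_mul, mul_pow]
    · exact (memLp_torusChar _).1.enorm.pow_const 2
    · exact (memLp_radial hlam p).1.enorm.pow_const 2
  have h2 : eLpNorm (monoFun lam p) 2 (ballMeasure n lam) ^ 2 ≠ ∞ := by
    rw [h1]
    exact ENNReal.mul_ne_top (ENNReal.pow_ne_top (memLp_torusChar _).2.ne)
      (ENNReal.pow_ne_top (memLp_radial hlam p).2.ne)
  by_contra hcon
  rw [not_lt, top_le_iff] at hcon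
  simp [hcon] at h2

/-- The monomial `√(C_p / (2π)ⁿ) z^p` as an element of the Bergman space. -/
def monoLp (hlam : -1 < lam) (p : Fin n → ℕ) : bergman n lam :=
  ⟨(memLp_monoFun hlam p).toLp, monoFun lam p, (differentiable_monoFun p).differentiableOn,
    (memLp_monoFun hlam p).coeFn_toLp⟩

lemma coeFn_monoLp (hlam : -1 < lam) (p : Fin n → ℕ) :
    (monoLp hlam p : Lp ℂ 2 (ballMeasure n lam)) =ᵐ[ballMeasure n lam] monoFun lam p :=
  (memLp_monoFun hlam p).coeFn_toLp

lemma integral_ballMeasure (hlam : -1 < lam) {F : (Fin n → ℂ) → ℂ}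
    (hF : AEStronglyMeasurable F (ballMeasure n lam)) :
    ∫ z, F z ∂ballMeasure n lam = ∫ x, F (kappa n x) ∂nu n lam := by
  have hmp := measurePreserving_kappa n hlam
  rw [← hmp.map_eq] at hF ⊢
  exact integral_map hmp.measurable.aemeasurable hF

lemma integral_conj_torusChar_mul (p q : Fin n → ℤ) :
    ∫ t, (starRingEnd ℂ) (torusChar p t) * torusChar q t ∂torusMeasure n =
      if p = q then 1 else 0 := by
  have h := orthonormal_iff_ite.1 (orthonormal_torusChar n) p q
  rw [L2.inner_def] at h
  rw [← h]
  refine integral_congr_ae ?_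
  filter_upwards [(memLp_torusChar p).coeFn_toLp, (memLp_torusChar q).coeFn_toLp] with t h1 h2
  rw [h1, h2, RCLike.inner_apply, mul_comm]

lemma momentH_kappa {t : Fin n → ℂ} (ht : ∀ j, ‖t j‖ = 1) {h : Fin n → ℝ}
    (hh : h ∈ posOrthant n) : momentH n (kappa n (t, h)) = h := by
  have hk : ∀ j, ‖kappa n (t, h) j‖ ^ 2 = simplexMap n h j := by
    intro j
    rw [kappa_eq hh]
    exact norm_sq_mul_sqrt (ht j) ((simplexMap_mem hh).1 j).le
  ext j
  simp only [momentH, hk]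
  exact simplexMap_leftInv hh j

/-- H ∘ κ is the projection to h, so in these coordinates the symbol does not depend on t. -/
lemma symbol_kappa_ae (hlam : -1 < lam) {a : (Fin n → ℂ) → ℂ} {f : (Fin n → ℝ) → ℂ}
    (haf : a =ᵐ[volume.restrict (unitBall n)] fun z => f (momentH n z)) :
    ∀ᵐ x ∂nu n lam, a (kappa n x) = f x.2 := by
  have h1 : a =ᵐ[ballMeasure n lam] fun z => f (momentH n z) :=
    (withDensity_absolutelyContinuous _ _).ae_le haf
  filter_upwards [ae_nu, (measurePreserving_kappa n hlam).quasiMeasurePreserving.ae h1]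
    with x hx hx2
  rw [hx2, momentH_kappa hx.1 hx.2]

/-- Both sides are the same Bochner integral after the density is absorbed, so no integrability of f
is required here. -/
lemma integral_radial_sq_mul (hlam : -1 < lam) (f : (Fin n → ℝ) → ℂ) (p : Fin n → ℕ) :
    ∫ h, (radial lam p h : ℂ) ^ 2 * f h ∂nuTilde n lam = gammaSeq lam f p := by
  have h1 : ∫ h, (radial lam p h : ℂ) ^ 2 * f h ∂nuTilde n lam =
      ∫ h in posOrthant n, (ENNReal.ofReal (nuDensity lam h)).toReal •
        ((radial lam p h : ℂ) ^ 2 * f h) :=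
    integral_withDensity_eq_integral_toReal_smul measurable_nuDensity.ennreal_ofReal
      (Eventually.of_forall fun _ => ENNReal.ofReal_lt_top) _
  rw [h1, gammaSeq, ← integral_const_mul]
  refine setIntegral_congr_fun (measurableSet_posOrthant n) fun h hh => ?_
  have h2 := nuDensity_mul_radial_sq hlam p hh
  rw [ENNReal.toReal_ofReal (nuDensity_pos hlam h).le, Complex.real_smul, ← mul_assoc,
    gammaIntegrand, ← mul_assoc]
  congr 1
  exact_mod_cast h2

lemma coeFn_mulOp {a : (Fin n → ℂ) → ℂ} (ha : MemLp a ∞ (volume.restrict (unitBall n)))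
    (g : Lp ℂ 2 (ballMeasure n lam)) :
    mulOp lam ha g =ᵐ[ballMeasure n lam] fun z => a z * g z := by
  have h1 := ContinuousLinearMap.coeFn_holder (ContinuousLinearMap.mul ℂ ℂ) (r := 2)
    ((memLp_top_ballMeasure (lam := lam) ha).toLp a) g
  filter_upwards [h1, (memLp_top_ballMeasure (lam := lam) ha).coeFn_toLp] with z h2 h3
  change ((ContinuousLinearMap.mul ℂ ℂ).holder 2
    ((memLp_top_ballMeasure (lam := lam) ha).toLp a) g) z = _
  rw [h2, h3]
  rfl

/-- The heart of the diagonalisation. In the coordinates (t, h) the integrand is a product: the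
characters integrate to the Kronecker delta because the symbol is free of t, and on the diagonal the
remaining integral is γ(p). -/
lemma inner_monoLp_mulOp (hlam : -1 < lam) {a : (Fin n → ℂ) → ℂ} {f : (Fin n → ℝ) → ℂ}
    (ha : MemLp a ∞ (volume.restrict (unitBall n)))
    (haf : a =ᵐ[volume.restrict (unitBall n)] fun z => f (momentH n z)) (p q : Fin n → ℕ) :
    inner ℂ (monoLp hlam p : Lp ℂ 2 (ballMeasure n lam)) (mulOp lam ha (monoLp hlam q)) =
      if p = q then gammaSeq lam f p else 0 := by
  have h1 : inner ℂ (monoLp hlam p : Lp ℂ 2 (ballMeasure n lam)) (mulOp lam ha (monoLp hlam q)) =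
      ∫ z, (starRingEnd ℂ) (monoFun lam p z) * (a z * monoFun lam q z) ∂ballMeasure n lam := by
    rw [L2.inner_def]
    refine integral_congr_ae ?_
    filter_upwards [coeFn_monoLp hlam p, coeFn_monoLp hlam q,
      coeFn_mulOp ha (monoLp hlam q : Lp ℂ 2 (ballMeasure n lam))] with z h2 h3 h4
    rw [h2, h4, h3, RCLike.inner_apply, mul_comm]
  have hm : AEStronglyMeasurable
      (fun z => (starRingEnd ℂ) (monoFun lam p z) * (a z * monoFun lam q z))
      (ballMeasure n lam) :=
    (measurable_monoFun p).aestronglyMeasurable.star.mul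
      ((memLp_top_ballMeasure ha).1.mul (measurable_monoFun q).aestronglyMeasurable)
  rw [h1, integral_ballMeasure hlam hm]
  have h5 : ∫ x, (starRingEnd ℂ) (monoFun lam p (kappa n x)) *
      (a (kappa n x) * monoFun lam q (kappa n x)) ∂nu n lam =
      ∫ x, ((starRingEnd ℂ) (torusChar (fun j => (p j : ℤ)) x.1) *
        torusChar (fun j => (q j : ℤ)) x.1) *
        ((radial lam p x.2 : ℂ) * (radial lam q x.2 : ℂ) * f x.2)
        ∂(torusMeasure n).prod (nuTilde n lam) := by
    refine integral_congr_ae ?_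
    filter_upwards [monoFun_kappa_ae p, monoFun_kappa_ae q, symbol_kappa_ae hlam haf]
      with x h2 h3 h4
    rw [h2, h3, h4, map_mul, Complex.conj_ofReal]
    ring
  rw [h5, integral_prod_mul (fun t => (starRingEnd ℂ) (torusChar (fun j => (p j : ℤ)) t) *
      torusChar (fun j => (q j : ℤ)) t)
      (fun h => (radial lam p h : ℂ) * (radial lam q h : ℂ) * f h), integral_conj_torusChar_mul]
  by_cases hpq : p = q
  · subst hpq
    rw [if_pos rfl, if_pos rfl, one_mul, ← integral_radial_sq_mul hlam]
    simp_rw [sq]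
  · rw [if_neg hpq, if_neg fun h => hpq (natCast_multiIndex_injective h), zero_mul]

lemma integral_radial_sq (hlam : -1 < lam) (p : Fin n → ℕ) :
    ∫ h, (radial lam p h : ℂ) ^ 2 ∂nuTilde n lam = (((poch (lam + 1) n)⁻¹ : ℝ) : ℂ) := by
  rw [← norm_radialLp_sq hlam p, Complex.ofReal_pow]
  have := inner_self_eq_norm_sq_to_K (𝕜 := ℂ) (radialLp hlam p)
  refine Eq.trans ?_ this
  rw [L2.inner_def]
  refine integral_congr_ae ?_
  filter_upwards [(memLp_radial hlam p).coeFn_toLp] with h h1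
  rw [radialLp, h1, RCLike.inner_apply, Complex.conj_ofReal, sq]

/-- The case of the constant symbol 1, for which γ(p) is the squared norm of the profile. -/
lemma inner_monoLp (hlam : -1 < lam) (p q : Fin n → ℕ) :
    inner ℂ (monoLp hlam p : Lp ℂ 2 (ballMeasure n lam)) (monoLp hlam q) =
      if p = q then (((poch (lam + 1) n)⁻¹ : ℝ) : ℂ) else 0 := by
  have h1 : MemLp (fun _ : Fin n → ℂ => (1 : ℂ)) ∞ (volume.restrict (unitBall n)) :=
    memLp_top_const 1
  have h2 := inner_monoLp_mulOp hlam h1 (f := fun _ => 1) (Eventually.of_forall fun _ => rfl) p q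
  have h3 : mulOp lam h1 (monoLp hlam q) = (monoLp hlam q : Lp ℂ 2 (ballMeasure n lam)) := by
    refine Lp.ext ((coeFn_mulOp h1 _).trans (Eventually.of_forall fun z => ?_))
    simp only [one_mul]
  rw [h3, ← integral_radial_sq_mul hlam] at h2
  rw [h2]
  simp only [mul_one, integral_radial_sq hlam]

end monomial

/-! ### The operator R_λ and convergence of the integrals γ -/

section transform

variable {n : ℕ} {lam : ℝ}

/-- The operator `U₀ g = g ∘ κ`. -/
def kappaOp (n : ℕ) (hlam : -1 < lam) : Lp ℂ 2 (ballMeasure n lam) →L[ℂ] Lp ℂ 2 (nu n lam) :=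
  (Lp.compMeasurePreservingₗᵢ ℂ (kappa n)
    (measurePreserving_kappa n hlam)).toContinuousLinearMap

lemma isU₀_kappaOp (hlam : -1 < lam) : IsU₀ (kappaOp n hlam) := fun g =>
  Lp.coeFn_compMeasurePreserving g (measurePreserving_kappa n hlam)

/-- The operator `R_λ = W_λ^* U₁ U₀`. -/
def bargmannOp (n : ℕ) (hlam : -1 < lam) : Lp ℂ 2 (ballMeasure n lam) →L[ℂ] ell2 n :=
  (radialOp hlam).adjoint ∘L fourierOp n lam ∘L kappaOp n hlam

/-- The p-th coordinate of W_λ^* x is ⟨W_λ δ_p, x⟩, and W_λ δ_p is concentrated at the single index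
p. -/
lemma bargmannOp_apply_eq_inner_radialLp (hlam : -1 < lam) (g : Lp ℂ 2 (ballMeasure n lam))
    (p : Fin n → ℕ) : bargmannOp n hlam g p =
      inner ℂ (radialLp hlam p) (fourierOp n lam (kappaOp n hlam g) fun j => (p j : ℤ)) := by
  refine Eq.trans ?_ (lp.inner_single_left (𝕜 := ℂ) (fun j => (p j : ℤ)) (radialLp hlam p)
    (fourierOp n lam (kappaOp n hlam g)))
  rw [← radialOp_single, ← ContinuousLinearMap.adjoint_inner_right]
  refine Eq.trans ?_ (lp.inner_single_left (𝕜 := ℂ) p (1 : ℂ) (bargmannOp n hlam g)).symm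
  rw [RCLike.inner_apply, map_one, mul_one]

/-- Fubini with t innermost: the Fourier coefficient followed by the pairing with the profile is one
integral against the conjugate monomial, pulled back by κ. -/
lemma bargmannOp_apply (hlam : -1 < lam) (g : Lp ℂ 2 (ballMeasure n lam)) (p : Fin n → ℕ) :
    bargmannOp n hlam g p = inner ℂ (monoLp hlam p : Lp ℂ 2 (ballMeasure n lam)) g := by
  have hint : Integrable (fun z => (starRingEnd ℂ) (monoFun lam p z) * g z)
      (ballMeasure n lam) := by
    refine (L2.integrable_inner (𝕜 := ℂ) (monoLp hlam p : Lp ℂ 2 (ballMeasure n lam)) g).congr ?_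
    filter_upwards [coeFn_monoLp hlam p] with z hz
    rw [hz, RCLike.inner_apply, mul_comm]
  have h2 : inner ℂ (monoLp hlam p : Lp ℂ 2 (ballMeasure n lam)) g =
      ∫ z, (starRingEnd ℂ) (monoFun lam p z) * g z ∂ballMeasure n lam := by
    rw [L2.inner_def]
    refine integral_congr_ae ?_
    filter_upwards [coeFn_monoLp hlam p] with z hz
    rw [hz, RCLike.inner_apply, mul_comm]
  have hint' : Integrable (fun x => (starRingEnd ℂ) (monoFun lam p (kappa n x)) * g (kappa n x))
      ((torusMeasure n).prod (nuTilde n lam)) :=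
    (measurePreserving_kappa n hlam).integrable_comp_of_integrable hint
  rw [bargmannOp_apply_eq_inner_radialLp, h2, L2.inner_def]
  refine Eq.trans ?_ ((integral_ballMeasure hlam hint.1).trans (integral_prod_symm _ hint')).symm
  refine integral_congr_ae ?_
  filter_upwards [(memLp_radial hlam p).coeFn_toLp,
    coeFn_fourierOp (kappaOp n hlam g) (fun j => (p j : ℤ)), ae_mem_posOrthant,
    ae_ae_of_ae_nu (isU₀_kappaOp hlam g)] with h h3 h4 hh h5
  rw [radialLp, h3, h4, fourierFiber, RCLike.inner_apply, Complex.conj_ofReal,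
    mul_assoc, mul_comm, mul_assoc, ← integral_mul_const]
  refine integral_congr_ae ?_
  filter_upwards [h5, ae_norm_eq_one_torusMeasure n] with t h6 ht
  rw [h6, monoFun_kappa p t hh, map_mul, Complex.conj_ofReal, torusChar, map_mul,
    Complex.conj_ofReal, conj_prod_zpow ht]
  ring

/-- Needed to discard t from a statement that holds for almost every t but does not mention t. -/
lemma torusMeasure_ne_zero (n : ℕ) : torusMeasure n ≠ 0 := by
  intro h
  have h1 := integral_prod_zpow_torusMeasure (n := n) 0
  rw [h, integral_zero_measure, if_pos rfl] at h1
  have : (0 : ℝ) < (2 * Real.pi) ^ n := by positivity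
  exact this.ne (by exact_mod_cast h1)

/-- Boundedness passes from a to f through κ. Since the density of ν̃_λ is positive, ν̃_λ-null sets
in the orthant are Lebesgue null. -/
lemma ae_symbol_bound {a : (Fin n → ℂ) → ℂ} {f : (Fin n → ℝ) → ℂ}
    (ha : MemLp a ∞ (volume.restrict (unitBall n)))
    (haf : a =ᵐ[volume.restrict (unitBall n)] fun z => f (momentH n z)) (hlam : -1 < lam) :
    ∃ C : ℝ, ∀ᵐ h ∂volume.restrict (posOrthant n), ‖f h‖ ≤ C := by
  have ha' := memLp_top_ballMeasure (lam := lam) ha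
  obtain ⟨C, hC⟩ : ∃ C : ℝ, ∀ᵐ z ∂ballMeasure n lam, ‖a z‖ ≤ C := by
    refine ⟨(eLpNormEssSup a (ballMeasure n lam)).toReal, ?_⟩
    have hfin : eLpNormEssSup a (ballMeasure n lam) ≠ ∞ := by
      have := ha'.2.ne
      rwa [eLpNorm_exponent_top] at this
    filter_upwards [enorm_ae_le_eLpNormEssSup a (ballMeasure n lam)] with z hz
    have := ENNReal.toReal_mono hfin hz
    rwa [toReal_enorm] at this
  refine ⟨C, ?_⟩
  have h1 : ∀ᵐ x ∂nu n lam, ‖f x.2‖ ≤ C := by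
    filter_upwards [symbol_kappa_ae hlam haf,
      (measurePreserving_kappa n hlam).quasiMeasurePreserving.ae hC] with x hx1 hx2
    rwa [← hx1]
  have : (ae (torusMeasure n)).NeBot := ae_neBot.2 (torusMeasure_ne_zero n)
  have h2 : ∀ᵐ h ∂nuTilde n lam, ‖f h‖ ≤ C := by
    filter_upwards [ae_ae_of_ae_nu h1] with h hh
    simpa using hh
  have h3 := (ae_withDensity_iff (measurable_nuDensity (n := n)
    (lam := lam)).ennreal_ofReal).1 h2
  filter_upwards [h3] with h hh
  exact hh (by simpa using nuDensity_pos hlam h)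

lemma integrableOn_gammaIntegrand {a : (Fin n → ℂ) → ℂ} {f : (Fin n → ℝ) → ℂ}
    (hf : AEStronglyMeasurable f (volume.restrict (posOrthant n)))
    (ha : MemLp a ∞ (volume.restrict (unitBall n)))
    (haf : a =ᵐ[volume.restrict (unitBall n)] fun z => f (momentH n z)) (hlam : -1 < lam)
    (p : Fin n → ℕ) : IntegrableOn (gammaIntegrand lam f p) (posOrthant n) := by
  obtain ⟨C, hC⟩ := ae_symbol_bound ha haf hlam
  have hl1 : Measurable (l1 : (Fin n → ℝ) → ℝ) := measurable_l1
  have h1 : IntegrableOn (fun h : Fin n → ℝ =>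
      (∏ j, h j ^ p j) / (1 + l1 h) ^ ((mlen p : ℝ) + n + lam + 1)) (posOrthant n) := by
    refine ⟨(by fun_prop : Measurable fun h : Fin n → ℝ =>
      (∏ j, h j ^ p j) / (1 + l1 h) ^ ((mlen p : ℝ) + n + lam + 1)).aestronglyMeasurable, ?_⟩
    rw [hasFiniteIntegral_iff_ofReal, lintegral_dirichlet hlam]
    · exact ENNReal.ofReal_lt_top
    · filter_upwards [ae_restrict_mem (measurableSet_posOrthant n)] with h hh
      exact div_nonneg (Finset.prod_nonneg fun j _ => pow_nonneg (hh j).le _)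
        (Real.rpow_nonneg (one_add_l1_pos h).le _)
  exact h1.ofReal.mul_bdd hf hC

end transform

/-! ### Fourier coefficients of a holomorphic function on circles -/

section cauchy

/-- Substitution w = ρ e^{2πis}. The contour integral is Cauchy's formula for the k-th Laurent
coefficient, so only ρ^k will depend on ρ once the contour can be moved. -/
lemma integral_fourier_mul_comp_toCircle (g : ℂ → ℂ) {ρ : ℝ} (hρ : 0 < ρ) (k : ℤ) :
    ∫ s : UnitAddCircle, fourier (-k) s * g (ρ * (AddCircle.toCircle s : ℂ))
        ∂AddCircle.haarAddCircle =
      (ρ : ℂ) ^ k * ((2 * Real.pi * Complex.I)⁻¹ * ∮ w in C(0, ρ), w ^ (-k - 1) * g w) := by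
  have hρ' : (ρ : ℂ) ≠ 0 := by exact_mod_cast hρ.ne'
  have hpi : (2 * Real.pi : ℝ) ≠ 0 := by positivity
  have hpi' : (Real.pi : ℂ) ≠ 0 := by exact_mod_cast Real.pi_ne_zero
  rw [AddCircle.integral_haarAddCircle, inv_one, one_smul,
    ← UnitAddCircle.intervalIntegral_preimage 0, zero_add, circleIntegral]
  have h1 := intervalIntegral.integral_comp_mul_left (a := 0) (b := 1)
    (fun θ => deriv (circleMap 0 ρ) θ • ((circleMap 0 ρ θ) ^ (-k - 1) * g (circleMap 0 ρ θ))) hpi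
  rw [mul_zero, mul_one] at h1
  have h2 : ∫ θ in (0 : ℝ)..(2 * Real.pi),
      deriv (circleMap 0 ρ) θ • ((circleMap 0 ρ θ) ^ (-k - 1) * g (circleMap 0 ρ θ)) =
      ((2 * Real.pi : ℝ) : ℂ) * ∫ x in (0 : ℝ)..1, deriv (circleMap 0 ρ) (2 * Real.pi * x) •
        ((circleMap 0 ρ (2 * Real.pi * x)) ^ (-k - 1) * g (circleMap 0 ρ (2 * Real.pi * x))) := by
    rw [h1, Complex.real_smul, ← mul_assoc, ← Complex.ofReal_mul, mul_inv_cancel₀ hpi]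
    simp
  rw [h2, ← intervalIntegral.integral_const_mul, ← intervalIntegral.integral_const_mul,
    ← intervalIntegral.integral_const_mul]
  refine intervalIntegral.integral_congr fun x _ => ?_
  have e : circleMap 0 ρ (2 * Real.pi * x) =
      ρ * (AddCircle.toCircle (x : UnitAddCircle) : ℂ) := by
    rw [circleMap, AddCircle.toCircle_apply_mk, Circle.coe_exp]
    push_cast
    simp
  have hne : (ρ : ℂ) * (AddCircle.toCircle (x : UnitAddCircle) : ℂ) ≠ 0 :=
    mul_ne_zero hρ' (Circle.coe_ne_zero _)
  have hf : fourier (-k) (x : UnitAddCircle) =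
      (AddCircle.toCircle (x : UnitAddCircle) : ℂ) ^ (-k) := by
    rw [fourier_apply, AddCircle.toCircle_zsmul, Circle.coe_zpow]
  simp only [deriv_circleMap, e, smul_eq_mul]
  rw [hf, zpow_sub_one₀ hne, mul_zpow, zpow_neg, zpow_neg]
  have h3 := zpow_ne_zero k hρ'
  have hI := Complex.I_ne_zero
  push_cast
  field_simp

/-- The integrand is holomorphic on the closed annulus even for negative k, because 0 is excluded.
-/
lemma circleIntegral_zpow_mul_eq {g : ℂ → ℂ} {R ρ σ : ℝ} (hρ : 0 < ρ) (hρσ : ρ ≤ σ) (hσ : σ < R)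
    (hg : DifferentiableOn ℂ g (Metric.ball 0 R)) (k : ℤ) :
    (∮ w in C(0, σ), w ^ k * g w) = ∮ w in C(0, ρ), w ^ k * g w := by
  have hd : ∀ w ∈ Metric.closedBall (0 : ℂ) σ \ Metric.ball 0 ρ,
      DifferentiableAt ℂ (fun w => w ^ k * g w) w := by
    intro w hw
    have hw0 : w ≠ 0 := by
      rintro rfl
      exact hw.2 (Metric.mem_ball_self hρ)
    refine (differentiableAt_zpow.2 (Or.inl hw0)).mul (hg.differentiableAt ?_)
    exact Metric.isOpen_ball.mem_nhds (Metric.closedBall_subset_ball hσ hw.1)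
  refine Complex.circleIntegral_eq_of_differentiable_on_annulus_off_countable hρ hρσ
    Set.countable_empty (fun w hw => (hd w hw).continuousAt.continuousWithinAt) fun w hw => ?_
  exact hd w ⟨Metric.ball_subset_closedBall hw.1.1, fun h =>
    hw.1.2 (Metric.ball_subset_closedBall h)⟩

lemma circleIntegral_zpow_mul_eq_zero {g : ℂ → ℂ} {R ρ : ℝ} (hρ : 0 < ρ) (hR : ρ < R)
    (hg : DifferentiableOn ℂ g (Metric.ball 0 R)) {k : ℤ} (hk : 0 ≤ k) :
    (∮ w in C(0, ρ), w ^ k * g w) = 0 := by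
  have hd : ∀ w ∈ Metric.closedBall (0 : ℂ) ρ, DifferentiableAt ℂ (fun w => w ^ k * g w) w := by
    intro w hw
    refine (differentiableAt_zpow.2 (Or.inr hk)).mul (hg.differentiableAt ?_)
    exact Metric.isOpen_ball.mem_nhds (Metric.closedBall_subset_ball hR hw)
  exact Complex.circleIntegral_eq_zero_of_differentiable_on_off_countable hρ.le
    Set.countable_empty (fun w hw => (hd w hw).continuousAt.continuousWithinAt) fun w hw =>
      hd w (Metric.ball_subset_closedBall hw.1)

/-- Dilating the circle multiplies the `k`-th Fourier coefficient of a holomorphic function by the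
`k`-th power of the dilation. -/
lemma integral_fourier_mul_dilate {g : ℂ → ℂ} {R ρ : ℝ} (hρ : 0 < ρ) (hρ1 : ρ ≤ 1) (hR : 1 < R)
    (hg : DifferentiableOn ℂ g (Metric.ball 0 R)) (k : ℤ) :
    ∫ s : UnitAddCircle, fourier (-k) s * g (ρ * (AddCircle.toCircle s : ℂ))
        ∂AddCircle.haarAddCircle =
      (ρ : ℂ) ^ k * ∫ s : UnitAddCircle, fourier (-k) s * g (AddCircle.toCircle s : ℂ)
        ∂AddCircle.haarAddCircle := by
  have h1 := integral_fourier_mul_comp_toCircle g one_pos k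
  simp only [Complex.ofReal_one, one_mul, one_zpow] at h1
  rw [integral_fourier_mul_comp_toCircle g hρ, h1, circleIntegral_zpow_mul_eq hρ hρ1 hR hg]

/-- For k < 0 the exponent -k - 1 is nonnegative, so there is no pole and Cauchy's theorem applies.
-/
lemma integral_fourier_mul_eq_zero {g : ℂ → ℂ} {R : ℝ} (hR : 1 < R)
    (hg : DifferentiableOn ℂ g (Metric.ball 0 R)) {k : ℤ} (hk : k < 0) :
    ∫ s : UnitAddCircle, fourier (-k) s * g (AddCircle.toCircle s : ℂ)
      ∂AddCircle.haarAddCircle = 0 := by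
  have h1 := integral_fourier_mul_comp_toCircle g one_pos k
  simp only [Complex.ofReal_one, one_mul, one_zpow] at h1
  rw [h1, circleIntegral_zpow_mul_eq_zero one_pos hR hg (by omega), mul_zero]

end cauchy

/-! ### Fourier coefficients on the tori inside the ball -/

section polydisc

variable {n : ℕ}

/-- The polyradii of the closed polydiscs centred at the origin and contained in the ball. -/
def polyradii (n : ℕ) : Set (Fin n → ℝ) := {r | (∀ j, 0 < r j) ∧ ∑ j, r j ^ 2 < 1}

/-- The point of the distinguished boundary of the polydisc of polyradius `r` with the given
arguments. -/
def torusPoint (r : Fin n → ℝ) (x : UnitAddTorus (Fin n)) : Fin n → ℂ :=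
  fun j => (AddCircle.toCircle (x j) : ℂ) * r j

/-- The normalised Haar measure on the torus `(ℝ / ℤ)ⁿ`. -/
def torusHaar (n : ℕ) : Measure (UnitAddTorus (Fin n)) :=
  Measure.pi fun _ => AddCircle.haarAddCircle

instance isProbabilityMeasure_torusHaar : IsProbabilityMeasure (torusHaar n) := by
  unfold torusHaar
  infer_instance

instance isAddHaarMeasure_torusHaar : (torusHaar n).IsAddHaarMeasure := by
  unfold torusHaar
  infer_instance

/-- The Fourier coefficients of a function on the distinguished boundary of a polydisc. -/
def polyCoeff (G : (Fin n → ℂ) → ℂ) (r : Fin n → ℝ) (q : Fin n → ℤ) : ℂ :=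
  ∫ x, UnitAddTorus.mFourier (-q) x * G (torusPoint r x) ∂torusHaar n

lemma norm_torusPoint {r : Fin n → ℝ} (hr : r ∈ polyradii n) (x : UnitAddTorus (Fin n))
    (j : Fin n) : ‖torusPoint r x j‖ = r j := by
  rw [torusPoint, norm_mul, Circle.norm_coe, one_mul, Complex.norm_real,
    Real.norm_of_nonneg (hr.1 j).le]

lemma torusPoint_mem_unitBall {r : Fin n → ℝ} (hr : r ∈ polyradii n)
    (x : UnitAddTorus (Fin n)) : torusPoint r x ∈ unitBall n := by
  simp only [unitBall, Set.mem_ofPred_eq, norm_torusPoint hr]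
  exact hr.2

lemma continuous_torusPoint (r : Fin n → ℝ) : Continuous (torusPoint r) := by
  refine continuous_pi fun j => ?_
  have h : Continuous fun x : UnitAddTorus (Fin n) => (AddCircle.toCircle (x j) : ℂ) :=
    continuous_subtype_val.comp (AddCircle.continuous_toCircle.comp (continuous_apply j))
  exact h.mul continuous_const

lemma continuous_comp_torusPoint {G : (Fin n → ℂ) → ℂ} (hG : DifferentiableOn ℂ G (unitBall n))
    {r : Fin n → ℝ} (hr : r ∈ polyradii n) : Continuous fun x => G (torusPoint r x) :=
  hG.continuousOn.comp_continuous (continuous_torusPoint r) (torusPoint_mem_unitBall hr)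

/-- Averaging over translations of the j-th coordinate leaves a Haar integral unchanged. This
creates a one-variable inner integral without splitting the product over `Fin n`. -/
lemma integral_torus_eq_integral_integral {F : UnitAddTorus (Fin n) → ℂ} (hF : Continuous F)
    (j : Fin n) :
    ∫ x, F x ∂torusHaar n =
      ∫ x, ∫ s : UnitAddCircle, F (x + Pi.single j s) ∂AddCircle.haarAddCircle ∂torusHaar n := by
  have hc : Continuous (fun z : UnitAddTorus (Fin n) × UnitAddCircle =>
      F (z.1 + Pi.single j z.2)) := by
    refine hF.comp (continuous_fst.add ?_)
    exact (continuous_single j).comp continuous_snd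
  have hint : Integrable (Function.uncurry fun (x : UnitAddTorus (Fin n)) (s : UnitAddCircle) =>
      F (x + Pi.single j s)) ((torusHaar n).prod AddCircle.haarAddCircle) :=
    hc.integrable_of_hasCompactSupport (HasCompactSupport.of_compactSpace _)
  rw [integral_integral_swap hint]
  simp_rw [integral_add_right_eq_self]
  simp

lemma fourier_add_apply (k : ℤ) (x y : UnitAddCircle) :
    fourier k (x + y) = fourier k x * fourier k y := by
  rw [fourier_apply, fourier_apply, fourier_apply, smul_add, AddCircle.toCircle_add,
    Circle.coe_mul]

lemma mFourier_add_single (q : Fin n → ℤ) (x : UnitAddTorus (Fin n)) (j : Fin n)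
    (s : UnitAddCircle) :
    UnitAddTorus.mFourier q (x + Pi.single j s) =
      UnitAddTorus.mFourier q x * fourier (q j) s := by
  change ∏ i, fourier (q i) (x i + (Pi.single j s : Fin n → UnitAddCircle) i) = (∏ i, fourier (q i) (x i)) * _
  simp_rw [fourier_add_apply]
  rw [Finset.prod_mul_distrib]
  congr 1
  rw [Finset.prod_eq_single j, Pi.single_eq_same]
  · intro i _ hi
    rw [Pi.single_eq_of_ne hi, fourier_eval_zero]
  · simp

/-- Scaling r_j by ρ and rotating x_j by s moves the point along the slice in the direction z_j,
with slice variable ζ = ρ e^{2πis}. -/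
lemma torusPoint_update_add_single (r : Fin n → ℝ) (x : UnitAddTorus (Fin n)) (j : Fin n)
    (s : UnitAddCircle) (ρ : ℝ) :
    torusPoint (Function.update r j (ρ * r j)) (x + Pi.single j s) =
      Function.update (torusPoint r x) j
        (((ρ : ℂ) * (AddCircle.toCircle s : ℂ)) * torusPoint r x j) := by
  ext i
  by_cases hi : i = j
  · subst hi
    simp only [torusPoint, Pi.add_apply, Pi.single_eq_same, Function.update_self,
      AddCircle.toCircle_add, Circle.coe_mul]
    push_cast
    ring
  · simp only [torusPoint, Pi.add_apply, Pi.single_eq_of_ne hi, Function.update_of_ne hi, add_zero]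

lemma update_mem_polyradii {r : Fin n → ℝ} (hr : r ∈ polyradii n) (j : Fin n) {ρ : ℝ}
    (hρ : 0 < ρ) (hρ1 : ρ ≤ 1) : Function.update r j (ρ * r j) ∈ polyradii n := by
  have h0 : ∀ i, 0 < Function.update r j (ρ * r j) i ∧ Function.update r j (ρ * r j) i ≤ r i := by
    intro i
    by_cases hi : i = j
    · subst hi
      rw [Function.update_self]
      exact ⟨mul_pos hρ (hr.1 i), mul_le_of_le_one_left (hr.1 i).le hρ1⟩
    · rw [Function.update_of_ne hi]
      exact ⟨hr.1 i, le_rfl⟩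
  refine ⟨fun i => (h0 i).1, lt_of_le_of_lt (Finset.sum_le_sum fun i _ => ?_) hr.2⟩
  exact pow_le_pow_left₀ (h0 i).1.le (h0 i).2 2

lemma polyCoeff_update_eq {G : (Fin n → ℂ) → ℂ} (hG : DifferentiableOn ℂ G (unitBall n))
    {r : Fin n → ℝ} (hr : r ∈ polyradii n) (j : Fin n) {ρ : ℝ} (hρ : 0 < ρ) (hρ1 : ρ ≤ 1)
    (q : Fin n → ℤ) :
    polyCoeff G (Function.update r j (ρ * r j)) q =
      ∫ x, UnitAddTorus.mFourier (-q) x * ∫ s : UnitAddCircle, fourier (-q j) s *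
        G (Function.update (torusPoint r x) j
          (((ρ : ℂ) * (AddCircle.toCircle s : ℂ)) * torusPoint r x j))
          ∂AddCircle.haarAddCircle ∂torusHaar n := by
  have hc : Continuous fun x => UnitAddTorus.mFourier (-q) x *
      G (torusPoint (Function.update r j (ρ * r j)) x) :=
    (UnitAddTorus.mFourier (-q)).continuous.mul
      (continuous_comp_torusPoint hG (update_mem_polyradii hr j hρ hρ1))
  rw [polyCoeff, integral_torus_eq_integral_integral hc j]
  refine integral_congr_ae (Eventually.of_forall fun x => ?_)
  simp only
  rw [← integral_const_mul]
  refine integral_congr_ae (Eventually.of_forall fun s => ?_)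
  simp only [torusPoint_update_add_single, mFourier_add_single, Pi.neg_apply]
  ring

/-- A slice of a holomorphic function on the ball through a point of a closed polydisc is
holomorphic on a disc of radius larger than one. -/
lemma exists_differentiableOn_slice {G : (Fin n → ℂ) → ℂ}
    (hG : DifferentiableOn ℂ G (unitBall n)) {r : Fin n → ℝ} (hr : r ∈ polyradii n)
    (x : UnitAddTorus (Fin n)) (j : Fin n) : ∃ R : ℝ, 1 < R ∧
      DifferentiableOn ℂ (fun ζ : ℂ => G (Function.update (torusPoint r x) j
        (ζ * torusPoint r x j))) (Metric.ball 0 R) := by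
  set σ := ∑ i, r i ^ 2 with hσ
  have hσ0 : 0 ≤ σ := Finset.sum_nonneg fun i _ => sq_nonneg _
  have hσ1 : σ < 1 := hr.2
  -- The radius R is chosen with R² = 2/(1 + σ) > 1 and R²σ = 2σ/(1 + σ) < 1. Enlarging every r_i²
  -- by R² then still stays in the ball.
  have hR2 : 1 < 2 / (1 + σ) := by
    rw [lt_div_iff₀ (by linarith)]
    linarith
  refine ⟨√(2 / (1 + σ)), Real.lt_sqrt_of_sq_lt (by rwa [one_pow]), ?_⟩
  refine hG.comp (Differentiable.differentiableOn ?_) fun ζ hζ => ?_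
  · refine differentiable_pi.2 fun i => ?_
    by_cases hi : i = j
    · subst hi
      simp only [Function.update_self]
      fun_prop
    · simp only [Function.update_of_ne hi]
      fun_prop
  · have hζ' : ‖ζ‖ ^ 2 ≤ 2 / (1 + σ) := by
      have h1 : ‖ζ‖ < √(2 / (1 + σ)) := by simpa using hζ
      rw [← Real.sq_sqrt (show 0 ≤ 2 / (1 + σ) by positivity)]
      exact pow_le_pow_left₀ (norm_nonneg _) h1.le 2
    have hle : ∑ i, ‖Function.update (torusPoint r x) j (ζ * torusPoint r x j) i‖ ^ 2 ≤
        ∑ i, 2 / (1 + σ) * r i ^ 2 := by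
      refine Finset.sum_le_sum fun i _ => ?_
      by_cases hi : i = j
      · subst hi
        rw [Function.update_self, norm_mul, norm_torusPoint hr, mul_pow]
        gcongr
      · rw [Function.update_of_ne hi, norm_torusPoint hr]
        exact le_mul_of_one_le_left (sq_nonneg _) hR2.le
    refine lt_of_le_of_lt hle ?_
    rw [← Finset.mul_sum, ← hσ, div_mul_eq_mul_div, div_lt_one (by linarith)]
    linarith

lemma polyCoeff_update {G : (Fin n → ℂ) → ℂ} (hG : DifferentiableOn ℂ G (unitBall n))
    {r : Fin n → ℝ} (hr : r ∈ polyradii n) (j : Fin n) {ρ : ℝ} (hρ : 0 < ρ) (hρ1 : ρ ≤ 1)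
    (q : Fin n → ℤ) :
    polyCoeff G (Function.update r j (ρ * r j)) q = (ρ : ℂ) ^ q j * polyCoeff G r q := by
  -- The case ρ = 1 writes the coefficient at r itself as the same iterated integral.
  have h1 := polyCoeff_update_eq hG hr j one_pos le_rfl q
  rw [one_mul, Function.update_eq_self] at h1
  rw [polyCoeff_update_eq hG hr j hρ hρ1, h1, ← integral_const_mul]
  refine integral_congr_ae (Eventually.of_forall fun x => ?_)
  obtain ⟨R, hR, hd⟩ := exists_differentiableOn_slice hG hr x j
  have h2 := integral_fourier_mul_dilate hρ hρ1 hR hd (q j)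
  simp only [Complex.ofReal_one, one_mul]
  rw [h2]
  ring

lemma polyCoeff_eq_zero {G : (Fin n → ℂ) → ℂ} (hG : DifferentiableOn ℂ G (unitBall n))
    {r : Fin n → ℝ} (hr : r ∈ polyradii n) {q : Fin n → ℤ} {j : Fin n} (hq : q j < 0) :
    polyCoeff G r q = 0 := by
  have h1 := polyCoeff_update_eq hG hr j one_pos le_rfl q
  rw [one_mul, Function.update_eq_self] at h1
  rw [h1]
  refine (integral_congr_ae (Eventually.of_forall fun x => ?_)).trans (integral_zero _ _)
  obtain ⟨R, hR, hd⟩ := exists_differentiableOn_slice hG hr x j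
  have h2 := integral_fourier_mul_eq_zero hR hd hq
  simp only [Complex.ofReal_one, one_mul]
  rw [h2, mul_zero]

/-- The coordinates are shrunk from r to m one at a time; each intermediate polyradius stays below
r, hence admissible. -/
lemma polyCoeff_piecewise {G : (Fin n → ℂ) → ℂ} (hG : DifferentiableOn ℂ G (unitBall n))
    {r m : Fin n → ℝ} (hr : r ∈ polyradii n) (hm : ∀ j, 0 < m j) (hmr : ∀ j, m j ≤ r j)
    (q : Fin n → ℤ) (S : Finset (Fin n)) :
    S.piecewise m r ∈ polyradii n ∧
      polyCoeff G (S.piecewise m r) q =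
        (∏ j ∈ S, ((m j / r j : ℝ) : ℂ) ^ q j) * polyCoeff G r q := by
  induction S using Finset.induction_on with
  | empty => simpa using hr
  | insert j S hj ih =>
    have hρ : 0 < m j / r j := div_pos (hm j) (hr.1 j)
    have hρ1 : m j / r j ≤ 1 := (div_le_one (hr.1 j)).2 (hmr j)
    have e : (insert j S).piecewise m r =
        Function.update (S.piecewise m r) j (m j / r j * S.piecewise m r j) := by
      rw [Finset.piecewise_insert, Finset.piecewise_eq_of_notMem _ _ _ hj,
        div_mul_cancel₀ _ (hr.1 j).ne']
    rw [e]
    refine ⟨update_mem_polyradii ih.1 j hρ hρ1, ?_⟩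
    rw [polyCoeff_update hG ih.1 j hρ hρ1, ih.2, Finset.prod_insert hj, mul_assoc]

lemma polyCoeff_of_le {G : (Fin n → ℂ) → ℂ} (hG : DifferentiableOn ℂ G (unitBall n))
    {r m : Fin n → ℝ} (hr : r ∈ polyradii n) (hm : ∀ j, 0 < m j) (hmr : ∀ j, m j ≤ r j)
    (q : Fin n → ℤ) :
    (∏ j, (m j : ℂ) ^ (-q j)) * polyCoeff G m q = (∏ j, (r j : ℂ) ^ (-q j)) * polyCoeff G r q := by
  have h := (polyCoeff_piecewise hG hr hm hmr q Finset.univ).2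
  rw [Finset.piecewise_univ] at h
  rw [h, ← mul_assoc, ← Finset.prod_mul_distrib]
  congr 1
  refine Finset.prod_congr rfl fun j _ => ?_
  have h1 : (m j : ℂ) ≠ 0 := by exact_mod_cast (hm j).ne'
  rw [Complex.ofReal_div, div_zpow, zpow_neg, zpow_neg, div_eq_mul_inv, ← mul_assoc,
    inv_mul_cancel₀ (zpow_ne_zero _ h1), one_mul]

/-- The Fourier coefficients of a holomorphic function on the ball are proportional to monomials
in the polyradius. -/
lemma exists_polyCoeff_eq {G : (Fin n → ℂ) → ℂ} (hG : DifferentiableOn ℂ G (unitBall n))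
    (q : Fin n → ℤ) : ∃ c : ℂ, ∀ r ∈ polyradii n, polyCoeff G r q = c * ∏ j, (r j : ℂ) ^ q j := by
  by_cases hne : (polyradii n).Nonempty
  · obtain ⟨r₀, hr₀⟩ := hne
    refine ⟨(∏ j, (r₀ j : ℂ) ^ (-q j)) * polyCoeff G r₀ q, fun r hr => ?_⟩
    -- Coefficients compare only under shrinking, so r and r₀ are compared through their
    -- coordinatewise minimum.
    have hm : ∀ j, 0 < min (r j) (r₀ j) := fun j => lt_min (hr.1 j) (hr₀.1 j)
    rw [← polyCoeff_of_le hG hr₀ hm (fun j => min_le_right _ _),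
      polyCoeff_of_le hG hr hm (fun j => min_le_left _ _), mul_right_comm,
      ← Finset.prod_mul_distrib, Finset.prod_eq_one, one_mul]
    intro j _
    have h1 : (r j : ℂ) ≠ 0 := by exact_mod_cast (hr.1 j).ne'
    rw [zpow_neg, inv_mul_cancel₀ (zpow_ne_zero _ h1)]
  · exact ⟨0, fun r hr => absurd ⟨r, hr⟩ hne⟩

/-- Vanishing coefficients are trivially summable, so the Fourier series of this continuous function
converges to it at every point, and the series is zero. -/
lemma eq_zero_of_polyCoeff_eq_zero {G : (Fin n → ℂ) → ℂ}
    (hG : DifferentiableOn ℂ G (unitBall n)) {r : Fin n → ℝ} (hr : r ∈ polyradii n)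
    (h : ∀ q, polyCoeff G r q = 0) (x : UnitAddTorus (Fin n)) : G (torusPoint r x) = 0 := by
  set f : C(UnitAddTorus (Fin n), ℂ) := ⟨_, continuous_comp_torusPoint hG hr⟩ with hf
  have h0 : UnitAddTorus.mFourierCoeff f = 0 := funext h
  have h1 := UnitAddTorus.hasSum_mFourier_series_apply_of_summable (f := f)
    (by rw [h0]; exact summable_zero) x
  rw [h0] at h1
  simp only [Pi.zero_apply, zero_smul] at h1
  exact h1.unique hasSum_zero

end polydisc

/-! ### Totality of the monomials -/

section completeness

variable {n : ℕ} {lam : ℝ}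

lemma lintegral_arcMeasure_eq (F : ℝ → ℝ≥0∞) :
    ∫⁻ θ in Set.Ioc (-Real.pi) Real.pi, F θ =
      ENNReal.ofReal (2 * Real.pi) *
        ∫⁻ x in Set.Ioc (-(1 / 2) : ℝ) (-(1 / 2) + 1), F (2 * Real.pi * x) := by
  have hpi : (0 : ℝ) < 2 * Real.pi := by positivity
  have himg : (fun x : ℝ => 2 * Real.pi * x) '' Set.Ioc (-(1 / 2) : ℝ) (-(1 / 2) + 1) =
      Set.Ioc (-Real.pi) Real.pi := by
    rw [Set.image_mul_left_Ioc hpi]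
    congr 1 <;> ring
  have h := lintegral_image_eq_lintegral_abs_deriv_mul (measurableSet_Ioc)
    (fun x _ => by simpa using ((hasDerivAt_id x).const_mul (2 * Real.pi)).hasDerivWithinAt)
    (mul_right_injective₀ hpi.ne').injOn F (s := Set.Ioc (-(1 / 2) : ℝ) (-(1 / 2) + 1))
    (f := fun x : ℝ => 2 * Real.pi * x) (f' := fun _ => 2 * Real.pi)
  rw [himg] at h
  rw [h, abs_of_pos hpi, lintegral_const_mul' _ _ ENNReal.ofReal_ne_top]

lemma measurable_coe_toCircle :
    Measurable fun s : UnitAddCircle => (AddCircle.toCircle s : ℂ) :=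
  (continuous_subtype_val.comp AddCircle.continuous_toCircle).measurable

/-- Links dt/(it), of mass 2π on 𝕋 ⊆ ℂ, to the normalised Haar measure of ℝ/ℤ used for the Fourier
coefficients on tori. -/
lemma arcMeasure_eq : arcMeasure = ENNReal.ofReal (2 * Real.pi) •
    AddCircle.haarAddCircle.map fun s : UnitAddCircle => (AddCircle.toCircle s : ℂ) := by
  have hv : (volume : Measure UnitAddCircle) = AddCircle.haarAddCircle := by
    rw [AddCircle.volume_eq_smul_haarAddCircle, ENNReal.ofReal_one, one_smul]
  refine Measure.ext_of_lintegral _ fun F hF => ?_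
  rw [arcMeasure, lintegral_map hF measurable_cexp_ofReal_mul_I, lintegral_arcMeasure_eq,
    lintegral_smul_measure, lintegral_map hF measurable_coe_toCircle, ← hv,
    ← UnitAddCircle.lintegral_preimage (-(1 / 2)), smul_eq_mul]
  congr 1
  refine lintegral_congr fun x => ?_
  rw [AddCircle.toCircle_apply_mk, Circle.coe_exp]
  congr 3
  simp

lemma torusMeasure_eq (n : ℕ) : torusMeasure n = ENNReal.ofReal (2 * Real.pi) ^ n •
    (torusHaar n).map fun x j => (AddCircle.toCircle (x j) : ℂ) := by
  have : IsFiniteMeasure (AddCircle.haarAddCircle.map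
      fun s : UnitAddCircle => (AddCircle.toCircle s : ℂ)) := inferInstance
  have h1 := (measurePreserving_pi (fun _ : Fin n => AddCircle.haarAddCircle)
    (fun _ => AddCircle.haarAddCircle.map fun s : UnitAddCircle => (AddCircle.toCircle s : ℂ))
    fun _ => ⟨measurable_coe_toCircle, rfl⟩).map_eq
  rw [torusHaar, h1]
  refine Measure.pi_eq fun s hs => ?_
  rw [Measure.smul_apply, Measure.pi_pi, arcMeasure_eq]
  simp [Finset.prod_mul_distrib]

/-- An embedding lets `integral_torusMeasure` hold for arbitrary F, without a measurability
hypothesis. -/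
lemma measurableEmbedding_toCircle (n : ℕ) : MeasurableEmbedding
    fun (x : UnitAddTorus (Fin n)) (j : Fin n) => (AddCircle.toCircle (x j) : ℂ) := by
  refine (Continuous.isClosedEmbedding ?_ ?_).measurableEmbedding
  · exact continuous_pi fun j =>
      continuous_subtype_val.comp (AddCircle.continuous_toCircle.comp (continuous_apply j))
  · intro x y h
    ext j
    exact AddCircle.injective_toCircle one_ne_zero (Subtype.ext (congrFun h j))

lemma integral_torusMeasure (F : (Fin n → ℂ) → ℂ) :
    ∫ t, F t ∂torusMeasure n = (((2 * Real.pi) ^ n : ℝ) : ℂ) *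
      ∫ x, F (fun j => (AddCircle.toCircle (x j) : ℂ)) ∂torusHaar n := by
  rw [torusMeasure_eq, integral_smul_measure, (measurableEmbedding_toCircle n).integral_map,
    ENNReal.toReal_pow, ENNReal.toReal_ofReal (by positivity), Complex.real_smul]

/-- The polyradius of the torus orbit with moment coordinates `h`. -/
def radius (h : Fin n → ℝ) : Fin n → ℝ := fun j => simplexMap n h j ^ (1 / 2 : ℝ)

lemma radius_mem_polyradii {h : Fin n → ℝ} (hh : h ∈ posOrthant n) :
    radius h ∈ polyradii n := by
  have hs := simplexMap_mem hh
  refine ⟨fun j => Real.rpow_pos_of_pos (hs.1 j) _, ?_⟩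
  have e : ∀ j, radius h j ^ 2 = simplexMap n h j := fun j => by
    rw [radius, ← Real.sqrt_eq_rpow, Real.sq_sqrt (hs.1 j).le]
  simp_rw [e]
  exact hs.2

lemma kappa_toCircle {h : Fin n → ℝ} (hh : h ∈ posOrthant n) (x : UnitAddTorus (Fin n)) :
    kappa n (fun j => (AddCircle.toCircle (x j) : ℂ), h) = torusPoint (radius h) x := by
  rw [kappa_eq hh]
  rfl

lemma mFourier_eq_prod (q : Fin n → ℤ) (x : UnitAddTorus (Fin n)) :
    UnitAddTorus.mFourier q x = ∏ j, (AddCircle.toCircle (x j) : ℂ) ^ q j := by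
  change ∏ j, fourier (q j) (x j) = _
  refine Finset.prod_congr rfl fun j _ => ?_
  rw [fourier_apply, AddCircle.toCircle_zsmul, Circle.coe_zpow]

lemma fourierFiber_comp_kappa (G : (Fin n → ℂ) → ℂ) (q : Fin n → ℤ) {h : Fin n → ℝ}
    (hh : h ∈ posOrthant n) : fourierFiber (fun x => G (kappa n x)) q h =
      (torusConst n : ℂ) * ((((2 * Real.pi) ^ n : ℝ) : ℂ) * polyCoeff G (radius h) q) := by
  rw [fourierFiber, integral_torusMeasure, polyCoeff]
  simp_rw [kappa_toCircle hh, mFourier_eq_prod, Pi.neg_apply, mul_comm (G _)]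

lemma torusConst_ne_zero (n : ℕ) : torusConst n ≠ 0 := by
  intro h
  simpa [h] using torusConst_sq n

/-- `monoFun_kappa` at t = (1, …, 1). It exhibits the profile as the monomial r^p in the polyradius,
the same dependence that `exists_polyCoeff_eq` gives for Fourier coefficients. -/
lemma radial_eq (p : Fin n → ℕ) {h : Fin n → ℝ} (hh : h ∈ posOrthant n) :
    (radial lam p h : ℂ) = (√(radialConst lam p) : ℂ) * ∏ j, (radius h j : ℂ) ^ (p j : ℤ) := by
  have h1 := monoFun_kappa (lam := lam) p (fun _ => 1) hh
  have hc : (torusConst n : ℂ) ≠ 0 := by exact_mod_cast torusConst_ne_zero n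
  rw [monoFun, kappa_eq hh, torusChar] at h1
  simp only [one_mul, one_zpow, Finset.prod_const_one, mul_one, Complex.ofReal_mul, mul_assoc] at h1
  rw [← mul_left_cancel₀ hc h1]
  simp only [radius, zpow_natCast]

/-- The monomials are total in the Bergman space. -/
lemma eq_zero_of_inner_monoLp_eq_zero (hlam : -1 < lam) (g : bergman n lam)
    (hg : ∀ p : Fin n → ℕ, inner ℂ (monoLp hlam p : Lp ℂ 2 (ballMeasure n lam))
      (g : Lp ℂ 2 (ballMeasure n lam)) = 0) : g = 0 := by
  obtain ⟨G, hG, hgG⟩ := g.2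
  have hkG : kappaOp n hlam g =ᵐ[nu n lam] fun x => G (kappa n x) := by
    filter_upwards [isU₀_kappaOp hlam (g : Lp ℂ 2 (ballMeasure n lam)),
      (measurePreserving_kappa n hlam).quasiMeasurePreserving.ae hgG] with x h1 h2
    rw [h1, h2]
  have hnat : ∀ (p : Fin n → ℕ), ∀ r ∈ polyradii n,
      polyCoeff G r (fun j => (p j : ℤ)) = 0 := by
    intro p
    obtain ⟨c, hc⟩ := exists_polyCoeff_eq hG (fun j => (p j : ℤ))
    have hsq : (√(radialConst lam p) : ℂ) ≠ 0 := by
      exact_mod_cast (Real.sqrt_pos.2 (radialConst_pos hlam p)).ne'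
    have htc : (torusConst n : ℂ) ≠ 0 := by exact_mod_cast torusConst_ne_zero n
    have hpi : (((2 * Real.pi) ^ n : ℝ) : ℂ) ≠ 0 := by
      have : (0 : ℝ) < (2 * Real.pi) ^ n := by positivity
      exact_mod_cast this.ne'
    -- The p-th fibrewise Fourier coefficient of G ∘ κ is a constant multiple d of the profile.
    -- Hence ⟨e_p, g⟩ = d ‖profile‖², and orthogonality gives d = 0, so c = 0.
    set d : ℂ := (torusConst n : ℂ) * (((2 * Real.pi) ^ n : ℝ) : ℂ) * c /
      (√(radialConst lam p) : ℂ) with hd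
    have h1 : fourierOp n lam (kappaOp n hlam g) (fun j => (p j : ℤ)) =
        d • radialLp hlam p := by
      refine Lp.ext ?_
      filter_upwards [coeFn_fourierOp (kappaOp n hlam g) (fun j => (p j : ℤ)),
        fourierFiber_congr hkG (fun j => (p j : ℤ)), ae_mem_posOrthant,
        Lp.coeFn_smul d (radialLp hlam p), (memLp_radial hlam p).coeFn_toLp] with h h2 h3 hh h4 h5
      rw [h2, h3, fourierFiber_comp_kappa G _ hh, h4, Pi.smul_apply, radialLp, h5,
        hc _ (radius_mem_polyradii hh), radial_eq p hh, hd, smul_eq_mul]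
      field_simp
    have h2 := bargmannOp_apply hlam (g : Lp ℂ 2 (ballMeasure n lam)) p
    rw [hg, bargmannOp_apply_eq_inner_radialLp, h1, inner_smul_right,
      inner_self_eq_norm_sq_to_K] at h2
    have h3 := norm_radialLp_sq hlam p
    have hP := poch_lam_pos (n := n) hlam
    have hnz : ((‖radialLp hlam p‖ : ℝ) : ℂ) ^ 2 ≠ 0 := by
      have : (0 : ℝ) < ‖radialLp hlam p‖ ^ 2 := by rw [h3]; positivity
      exact_mod_cast this.ne'
    have hd0 : d = 0 := (mul_eq_zero.1 h2).resolve_right hnz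
    have hc0 : c = 0 := by
      rw [hd, div_eq_zero_iff] at hd0
      exact (mul_eq_zero.1 (hd0.resolve_right hsq)).resolve_left (mul_ne_zero htc hpi)
    intro r hr
    rw [hc r hr, hc0, zero_mul]
  have hall : ∀ r ∈ polyradii n, ∀ q, polyCoeff G r q = 0 := by
    intro r hr q
    by_cases hq : ∃ j, q j < 0
    · obtain ⟨j, hj⟩ := hq
      exact polyCoeff_eq_zero hG hr hj
    · push Not at hq
      have : q = fun j => ((q j).toNat : ℤ) := funext fun j => (Int.toNat_of_nonneg (hq j)).symm
      rw [this]
      exact hnat _ r hr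
  -- G vanishes on every torus with positive radii, and these fill ν_λ-almost everything; since U₀
  -- is isometric, the class g is then zero.
  have hzero : kappaOp n hlam (g : Lp ℂ 2 (ballMeasure n lam)) = 0 := by
    refine Lp.ext ?_
    filter_upwards [hkG, ae_nu, Lp.coeFn_zero ℂ 2 (nu n lam)] with x h1 h2 h3
    rw [h1, h3, Pi.zero_apply]
    have hx : ∃ y : UnitAddTorus (Fin n), x.1 = fun j => (AddCircle.toCircle (y j) : ℂ) := by
      have : ∀ j, ∃ y : UnitAddCircle, (AddCircle.toCircle y : ℂ) = x.1 j := by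
        intro j
        obtain ⟨y, hy⟩ := (AddCircle.homeomorphCircle (T := 1) one_ne_zero).surjective
          ⟨x.1 j, by simpa [Submonoid.unitSphere] using h2.1 j⟩
        refine ⟨y, ?_⟩
        rw [← AddCircle.homeomorphCircle_apply one_ne_zero, hy]
      choose y hy using this
      exact ⟨y, funext fun j => (hy j).symm⟩
    obtain ⟨y, hy⟩ := hx
    have hxe : x = (fun j => (AddCircle.toCircle (y j) : ℂ), x.2) := by rw [← hy]
    rw [hxe, kappa_toCircle h2.2]
    exact eq_zero_of_polyCoeff_eq_zero hG (radius_mem_polyradii h2.2)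
      (hall _ (radius_mem_polyradii h2.2)) y
  refine Subtype.ext ?_
  exact (Lp.compMeasurePreservingₗᵢ ℂ (kappa n)
    (measurePreserving_kappa n hlam)).injective (hzero.trans (map_zero _).symm)

end completeness

/-! ### The Hilbert basis and diagonalisation -/

section unitary

variable {n : ℕ} {lam : ℝ}

lemma completeSpace_bergman (n : ℕ) (hlam : -1 < lam) : CompleteSpace (bergman n lam) :=
  (isClosed_bergman n hlam).completeSpace_coe

/-- The normalised monomials. -/
def monoBasisVec (hlam : -1 < lam) (p : Fin n → ℕ) : bergman n lam :=
  ((√(poch (lam + 1) n) : ℝ) : ℂ) • monoLp hlam p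

lemma sqrt_poch_mul_self (hlam : -1 < lam) :
    ((√(poch (lam + 1) n) : ℝ) : ℂ) * ((√(poch (lam + 1) n) : ℝ) : ℂ) = (poch (lam + 1) n : ℂ) := by
  rw [← Complex.ofReal_mul, Real.mul_self_sqrt (poch_lam_pos hlam).le]

lemma sqrt_poch_ne_zero (n : ℕ) (hlam : -1 < lam) : ((√(poch (lam + 1) n) : ℝ) : ℂ) ≠ 0 := by
  exact_mod_cast (Real.sqrt_pos.2 (poch_lam_pos hlam)).ne'

lemma inner_monoBasisVec (hlam : -1 < lam) (p : Fin n → ℕ) (g : bergman n lam) :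
    inner ℂ (monoBasisVec hlam p) g = ((√(poch (lam + 1) n) : ℝ) : ℂ) *
      inner ℂ (monoLp hlam p : Lp ℂ 2 (ballMeasure n lam)) (g : Lp ℂ 2 (ballMeasure n lam)) := by
  rw [Submodule.coe_inner, monoBasisVec, Submodule.coe_smul, inner_smul_left, Complex.conj_ofReal]

lemma orthonormal_monoBasisVec (hlam : -1 < lam) :
    Orthonormal ℂ (monoBasisVec (n := n) hlam) := by
  rw [orthonormal_iff_ite]
  intro p q
  have h := inner_monoLp hlam p q
  have hP := poch_lam_pos (n := n) hlam
  rw [inner_monoBasisVec, monoBasisVec, Submodule.coe_smul, inner_smul_right, h, ← mul_assoc, sqrt_poch_mul_self hlam]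
  split_ifs
  · rw [← Complex.ofReal_mul, mul_inv_cancel₀ hP.ne', Complex.ofReal_one]
  · rw [mul_zero]

lemma orthogonal_span_monoBasisVec (hlam : -1 < lam) :
    (Submodule.span ℂ (Set.range (monoBasisVec (n := n) hlam)))ᗮ = ⊥ := by
  rw [Submodule.eq_bot_iff]
  intro g hg
  refine eq_zero_of_inner_monoLp_eq_zero hlam g fun p => ?_
  have h := (Submodule.mem_orthogonal _ g).1 hg _ (Submodule.subset_span ⟨p, rfl⟩)
  rw [inner_monoBasisVec] at h
  exact (mul_eq_zero.1 h).resolve_left (sqrt_poch_ne_zero n hlam)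

/-- The Hilbert basis of normalised monomials of the Bergman space. -/
def monoBasis (n : ℕ) (hlam : -1 < lam) : HilbertBasis (Fin n → ℕ) ℂ (bergman n lam) :=
  haveI := completeSpace_bergman n hlam
  HilbertBasis.mkOfOrthogonalEqBot (orthonormal_monoBasisVec hlam)
    (orthogonal_span_monoBasisVec hlam)

lemma monoBasis_apply (hlam : -1 < lam) (p : Fin n → ℕ) :
    monoBasis n hlam p = monoBasisVec hlam p := by
  have := completeSpace_bergman n hlam
  exact congrFun (HilbertBasis.coe_mkOfOrthogonalEqBot (orthonormal_monoBasisVec hlam)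
    (orthogonal_span_monoBasisVec hlam)) p

lemma repr_monoBasis_apply (hlam : -1 < lam) (g : bergman n lam) (p : Fin n → ℕ) :
    (monoBasis n hlam).repr g p = ((√(poch (lam + 1) n) : ℝ) : ℂ) *
      inner ℂ (monoLp hlam p : Lp ℂ 2 (ballMeasure n lam)) (g : Lp ℂ 2 (ballMeasure n lam)) := by
  rw [HilbertBasis.repr_apply_apply, monoBasis_apply, inner_monoBasisVec]

lemma repr_monoBasis (hlam : -1 < lam) (g : bergman n lam) :
    (monoBasis n hlam).repr g = ((√(poch (lam + 1) n) : ℝ) : ℂ) • bargmannOp n hlam g := by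
  refine lp.ext (funext fun p => ?_)
  rw [repr_monoBasis_apply, ← bargmannOp_apply]
  rfl

/-- A continuous functional is applied termwise to the expansion of V_λ^{-1}ψ, and only the term q =
p survives. One factor √(λ+1)_n comes from V_λ and one from the basis vector, whence (λ+1)_n. -/
lemma repr_toeplitz (hlam : -1 < lam) {a : (Fin n → ℂ) → ℂ} {f : (Fin n → ℝ) → ℂ}
    (ha : MemLp a ∞ (volume.restrict (unitBall n)))
    (haf : a =ᵐ[volume.restrict (unitBall n)] fun z => f (momentH n z)) (ψ : ell2 n)
    (p : Fin n → ℕ) :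
    (monoBasis n hlam).repr (toeplitz hlam ha ((monoBasis n hlam).repr.symm ψ)) p =
      (poch (lam + 1) n : ℂ) * gammaSeq lam f p * ψ p := by
  have := hasOrthogonalProjection_bergman n hlam
  -- The projection B_λ drops out because it is paired with a vector of the Bergman space.
  have h1 : ∀ y : bergman n lam,
      inner ℂ (monoLp hlam p : Lp ℂ 2 (ballMeasure n lam))
        (toeplitz hlam ha y : Lp ℂ 2 (ballMeasure n lam)) =
      inner ℂ (monoLp hlam p : Lp ℂ 2 (ballMeasure n lam)) (mulOp lam ha y) := fun y =>
    Submodule.inner_orthogonalProjectionOnto_eq_of_mem_left (monoLp hlam p) (mulOp lam ha y)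
  have h2 := ((monoBasis n hlam).hasSum_repr_symm ψ).mapL
    (innerSL ℂ (monoLp hlam p : Lp ℂ 2 (ballMeasure n lam)) ∘L mulOp lam ha ∘L
      (bergman n lam).subtypeL)
  have h3 : ∀ q, (innerSL ℂ (monoLp hlam p : Lp ℂ 2 (ballMeasure n lam)) ∘L mulOp lam ha ∘L
      (bergman n lam).subtypeL) (ψ q • monoBasis n hlam q) =
      if q = p then ψ p * (((√(poch (lam + 1) n) : ℝ) : ℂ) * gammaSeq lam f p) else 0 := by
    intro q
    rw [map_smul, monoBasis_apply, monoBasisVec, map_smul]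
    change ψ q * (((√(poch (lam + 1) n) : ℝ) : ℂ) *
      inner ℂ (monoLp hlam p : Lp ℂ 2 (ballMeasure n lam)) (mulOp lam ha (monoLp hlam q))) = _
    rw [inner_monoLp_mulOp hlam ha haf]
    by_cases hqp : q = p
    · subst hqp
      rw [if_pos rfl, if_pos rfl]
    · rw [if_neg hqp, if_neg (Ne.symm hqp), mul_zero, mul_zero]
  simp_rw [h3] at h2
  have h4 := h2.unique (hasSum_ite_eq p _)
  have h5 : inner ℂ (monoLp hlam p : Lp ℂ 2 (ballMeasure n lam))
      (mulOp lam ha ((monoBasis n hlam).repr.symm ψ)) =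
      ψ p * (((√(poch (lam + 1) n) : ℝ) : ℂ) * gammaSeq lam f p) := h4
  rw [repr_monoBasis_apply, h1, h5, ← sqrt_poch_mul_self hlam]
  ring

lemma bargmannOp_orthogonalProjection [(bergman n lam).HasOrthogonalProjection] (hlam : -1 < lam)
    (g : Lp ℂ 2 (ballMeasure n lam)) :
    bargmannOp n hlam ((bergman n lam).orthogonalProjectionOnto g : Lp ℂ 2 (ballMeasure n lam)) =
      bargmannOp n hlam g := by
  refine lp.ext (funext fun p => ?_)
  rw [bargmannOp_apply, bargmannOp_apply]
  exact Submodule.inner_orthogonalProjectionOnto_eq_of_mem_left (monoLp hlam p) g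

/-- R_λ factors as (λ+1)_n^{-1/2} V_λ B_λ with V_λ unitary, so its adjoint is (λ+1)_n^{-1/2}
V_λ^{-1}; in particular it takes values in the Bergman space. -/
lemma adjoint_bargmannOp (hlam : -1 < lam) (ψ : ell2 n) :
    (bargmannOp n hlam).adjoint ψ = ((((√(poch (lam + 1) n) : ℝ) : ℂ)⁻¹ •
      (monoBasis n hlam).repr.symm ψ : bergman n lam) : Lp ℂ 2 (ballMeasure n lam)) := by
  have := hasOrthogonalProjection_bergman n hlam
  have hs := sqrt_poch_ne_zero n hlam
  refine ext_inner_right ℂ fun g => ?_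
  rw [ContinuousLinearMap.adjoint_inner_left, ← bargmannOp_orthogonalProjection,
    ← Submodule.inner_orthogonalProjectionOnto_eq_of_mem_left, inner_smul_left]
  set y := (bergman n lam).orthogonalProjectionOnto g
  have h1 := (monoBasis n hlam).repr.inner_map_map ((monoBasis n hlam).repr.symm ψ) y
  rw [LinearIsometryEquiv.apply_symm_apply, repr_monoBasis, inner_smul_right] at h1
  rw [← h1, map_inv₀, Complex.conj_ofReal, ← mul_assoc, inv_mul_cancel₀ hs, one_mul]

end unitary

end QuasiElliptic

end

open QuasiElliptic in
theorem mainTheorem4 (n : ℕ) (hn : 1 ≤ n) (a : (Fin n → ℂ) → ℂ) (f : (Fin n → ℝ) → ℂ)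
    (hf : AEStronglyMeasurable f (volume.restrict (posOrthant n)))
    (ha : MemLp a ∞ (volume.restrict (unitBall n)))
    (haf : a =ᵐ[volume.restrict (unitBall n)] fun z => f (momentH n z))
    (lam : ℝ) (hlam : -1 < lam) :
    (∀ p, IntegrableOn (gammaIntegrand lam f p) (posOrthant n)) ∧
    ∃ (U₀ : Lp ℂ 2 (ballMeasure n lam) →L[ℂ] Lp ℂ 2 (nu n lam))
      (U₁ : Lp ℂ 2 (nu n lam) →L[ℂ] ell2L2 n lam)
      (W : ell2 n →L[ℂ] ell2L2 n lam)
      (R : Lp ℂ 2 (ballMeasure n lam) →L[ℂ] ell2 n),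
      IsU₀ U₀ ∧ IsU₁ U₁ ∧ IsW W ∧ R = W.adjoint ∘L U₁ ∘L U₀ ∧
      (∀ ψ : ell2 n, ∃ hψ : R.adjoint ψ ∈ bergman n lam, ∀ p,
        R (toeplitz hlam ha ⟨R.adjoint ψ, hψ⟩) p = gammaSeq lam f p * ψ p) ∧
      ∃ V : bergman n lam ≃ₗᵢ[ℂ] ell2 n,
        (∀ g : bergman n lam, V g = ((√(poch (lam + 1) n) : ℝ) : ℂ) • R g) ∧
        ∀ (ψ : ell2 n) (p : Fin n → ℕ),
          V (toeplitz hlam ha (V.symm ψ)) p = (poch (lam + 1) n : ℂ) * gammaSeq lam f p * ψ p := by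
  refine ⟨integrableOn_gammaIntegrand hf ha haf hlam, kappaOp n hlam, fourierOp n lam,
    radialOp hlam, bargmannOp n hlam, isU₀_kappaOp hlam, isU₁_fourierOp, isW_radialOp hlam, rfl,
    fun ψ => ?_, (monoBasis n hlam).repr, repr_monoBasis hlam, repr_toeplitz hlam ha haf⟩
  have hadj := adjoint_bargmannOp hlam ψ
  refine ⟨hadj ▸ Subtype.coe_prop _, fun p => ?_⟩
  have hs := sqrt_poch_ne_zero n hlam
  have he : (⟨(bargmannOp n hlam).adjoint ψ, hadj ▸ Subtype.coe_prop _⟩ : bergman n lam) =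
      ((√(poch (lam + 1) n) : ℝ) : ℂ)⁻¹ • (monoBasis n hlam).repr.symm ψ := Subtype.ext hadj
  -- R_λ T R_λ^* is (λ+1)_n^{-1} V_λ T V_λ^{-1}, so the factor (λ+1)_n of the unitary form cancels.
  have h1 := repr_toeplitz hlam ha haf ψ p
  rw [repr_monoBasis_apply, ← sqrt_poch_mul_self hlam] at h1
  rw [he, map_smul, bargmannOp_apply, Submodule.coe_smul, inner_smul_right]
  field_simp
  refine mul_left_cancel₀ hs (h1.trans ?_)
  ring
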